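/- Let $q=p^e$ be a power of a prime $p$, let $\ell\ge 1$, and let $X$ be a smooth projective geometrically irreducible curve over $\mathbf F_{q^\ell}$ with function field $F$. For a divisor $A$ on $X$, let $\Omega(A)$ be the $\mathbf F_{q^\ell}$-space of rational differential forms $\omega\in\Omega_{F/\mathbf F_{q^\ell}}$ such that $v_P(\omega)\ge v_P(A)$ at every place $P$, and put $h^1(A)=\dim_{\mathbf F_{q^\ell}}\Omega(A)$. Let $\mathcal C$ be the Cartier operator on $\Omega_{F/\mathbf F_{q^\ell}}$: for a separating element $x$ of $F$ and $\omega=(f_0^p+f_1^px+\cdots+f_{p-1}^px^{p-1})\,dx$, one has $\mathcal C(\omega)=f_{p-1}\,dx$, which does not depend on $x$. Put $\mathcal C_q=\mathcal C^{e}$. Let $P_1,\dots,P_n$ be distinct $\mathbf F_{q^\ell}$-rational points of $X$ and $D=P_1+\cdots+P_n$. For a divisor $G$ on $X$ whose support is disjoint from that of $D$, let $$Car_q(D,G)=\{(\mathrm{res}_{P_1}(\omega),\dots,\mathrm{res}_{P_n}(\omega))\ :\ \omega\in\Omega(G-D),\ \mathcal C_q(\omega)=\omega\}\subseteq\mathbf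 F_q^n.$$ Let $G=G^+-G^-$, where $G^+,G^-\ge 0$, the divisor $G^-$ is reduced (all its multiplicities are equal to $1$), and $G^+$, $G^-$ and $D$ have pairwise disjoint supports. Let $s_{G^-}$ be the number of places in the support of $G^-$. Then $$\dim_{\mathbf F_q}Car_q(D,G)\ \ge\ n-1+s_{G^-}-\ell\deg(G^+)-h^1(G).$$ -/

import Mathlib

open scoped KaehlerDifferential

namespace CartierCode

/-- `F/K` is the function field of a smooth projective geometrically irreducible curve over the
(perfect) field `K`: a finite extension of `K(x)` for some transcendental `x`, in which `K` is
algebraically closed. -/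
structure IsFunctionField (K F : Type*) [Field K] [Field F] [Algebra K F] : Prop where
  exists_transcendental : ∃ x : F, Transcendental K x ∧
    FiniteDimensional (IntermediateField.adjoin K {x}) F
  full_constant_field : ∀ y : F, IsAlgebraic K y → y ∈ (algebraMap K F).range

/-- A place of `F/K`: a discrete valuation ring of `F` containing `K`. -/
structure Place (K F : Type*) [Field K] [Field F] [Algebra K F] where
  /-- the local ring at the place -/
  ring : ValuationSubring F
  algebraMap_mem : ∀ a : K, algebraMap K F a ∈ ring
  isDVR : IsDiscreteValuationRing ring

section

variable {K F : Type*} [Field K] [Field F] [Algebra K F]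

instance (P : Place K F) : IsDiscreteValuationRing P.ring := P.isDVR

instance (P : Place K F) : Algebra K P.ring :=
  ((algebraMap K F).codRestrict P.ring P.algebraMap_mem).toAlgebra

/-- The normalised discrete valuation at `P`, written multiplicatively:
`v_P(f) ≥ m` reads `P.val f ≤ WithZero.exp (-m)`. -/
noncomputable def Place.val (P : Place K F) : Valuation F (WithZero (Multiplicative ℤ)) :=
  (IsDiscreteValuationRing.maximalIdeal P.ring).valuation F

/-- `t` is a uniformising parameter at `P`: `v_P(t) = 1`. -/
def Place.IsUniformizer (P : Place K F) (t : F) : Prop :=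
  P.val t = WithZero.exp (-1 : ℤ)

/-- The degree of a place: the degree over `K` of its residue field. -/
noncomputable def Place.degree (P : Place K F) : ℕ :=
  Module.finrank K (IsLocalRing.ResidueField P.ring)

variable (K F) in
/-- Divisors: finitely supported integer combinations of places. -/
abbrev Divisor : Type _ := Place K F →₀ ℤ

/-- The degree of a divisor. -/
noncomputable def Divisor.deg (A : Divisor K F) : ℤ :=
  A.sum fun P m => m * (P.degree : ℤ)

/-- A divisor which is a sum of pairwise distinct places, each with multiplicity one. -/
def Divisor.IsReduced (A : Divisor K F) : Prop :=
  ∀ P ∈ A.support, A P = 1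

/-- The divisor `P₁ + ⋯ + Pₙ`. -/
noncomputable def Divisor.ofPoints {n : ℕ} (P : Fin n → Place K F) : Divisor K F :=
  ∑ i, Finsupp.single (P i) 1

/-- `v_P(ω) ≥ m`: writing `ω = f dt` with `t` a uniformising parameter at `P`, `v_P(f) ≥ m`. -/
def Place.OrdGE (P : Place K F) (ω : Ω[F⁄K]) (m : ℤ) : Prop :=
  ∀ t : F, P.IsUniformizer t →
    ∃ f : F, ω = f • KaehlerDifferential.D K F t ∧ P.val f ≤ WithZero.exp (-m)

/-- The `K`-space `Ω(A)` of rational differential forms `ω` such that `v_P(ω) ≥ v_P(A)` at every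
place `P`. -/
def Omega (A : Divisor K F) : Submodule K Ω[F⁄K] where
  carrier := {ω | ∀ P : Place K F, P.OrdGE ω (A P)}
  zero_mem' := fun P t _ => ⟨0, by simp, by simp⟩
  add_mem' := by
    intro ω η hω hη P t ht
    obtain ⟨f, rfl, hf⟩ := hω P t ht
    obtain ⟨g, rfl, hg⟩ := hη P t ht
    exact ⟨f + g, (add_smul _ _ _).symm, (P.val.map_add f g).trans (max_le hf hg)⟩
  smul_mem' := by
    intro c ω hω P t ht
    obtain ⟨f, rfl, hf⟩ := hω P t ht
    refine ⟨algebraMap K F c * f, by rw [mul_smul, algebraMap_smul], ?_⟩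
    have hc : P.val (algebraMap K F c) ≤ 1 :=
      IsDedekindDomain.HeightOneSpectrum.valuation_le_one
        (IsDiscreteValuationRing.maximalIdeal P.ring) ⟨_, P.algebraMap_mem c⟩
    rw [map_mul]
    calc P.val (algebraMap K F c) * P.val f ≤ 1 * P.val f := by gcongr
      _ ≤ _ := by rwa [one_mul]

/-- `h¹(A)`, the dimension of `Ω(A)` over the constant field `K`. -/
noncomputable def h1 (A : Divisor K F) : ℕ := Module.finrank K (Omega A)

/-- `c` is the residue of `ω` at the rational place `P`: if `t` is a uniformising parameter and
`ω = f dt`, then `f = ⋯ + a₂ t⁻³ + a₁ t⁻² + a₀ t⁻¹ + (a function regular at P)`, with finitely many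
polar terms, constants `aᵢ` in `K`, and `a₀ = c`. -/
def Place.HasResidue (P : Place K F) (ω : Ω[F⁄K]) (c : K) : Prop :=
  ∀ t : F, P.IsUniformizer t →
    ∃ f : F, ω = f • KaehlerDifferential.D K F t ∧
      ∃ (N : ℕ) (a : ℕ → K), a 0 = c ∧
        f - ∑ i ∈ Finset.range (N + 1), algebraMap K F (a i) * t⁻¹ ^ (i + 1) ∈ P.ring

/-- `η = 𝒞(ω)` for the Cartier operator `𝒞` in characteristic `p`: for every separating
element `x` (that is, `dx ≠ 0`), one has
`ω = (f₀ᵖ + f₁ᵖ x + ⋯ + f_{p-1}ᵖ x^{p-1}) dx` and `η = f_{p-1} dx`. -/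
def IsCartier (p : ℕ) (ω η : Ω[F⁄K]) : Prop :=
  ∀ x : F, KaehlerDifferential.D K F x ≠ 0 →
    ∃ f : ℕ → F,
      ω = (∑ i ∈ Finset.range p, f i ^ p * x ^ i) • KaehlerDifferential.D K F x ∧
      η = f (p - 1) • KaehlerDifferential.D K F x

/-- `η = 𝒞ᵉ(ω)` for the `e`-fold iterate of the Cartier operator. -/
def IsCartierIter (p : ℕ) : ℕ → Ω[F⁄K] → Ω[F⁄K] → Prop
  | 0, ω, η => ω = η
  | e + 1, ω, η => ∃ ξ : Ω[F⁄K], IsCartier p ω ξ ∧ IsCartierIter p e ξ η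

theorem HasResidue.add {P : Place K F} {ω η : Ω[F⁄K]} {c d : K}
    (hω : P.HasResidue ω c) (hη : P.HasResidue η d) : P.HasResidue (ω + η) (c + d) := by
  have pad : ∀ {f t : F} {N : ℕ} {a : ℕ → K} (M : ℕ), N ≤ M →
      f - ∑ i ∈ Finset.range (N + 1), algebraMap K F (a i) * t⁻¹ ^ (i + 1) ∈ P.ring →
      f - ∑ i ∈ Finset.range (M + 1),
        algebraMap K F (if i < N + 1 then a i else 0) * t⁻¹ ^ (i + 1) ∈ P.ring := by
    intro f t N a M hNM h
    convert h using 2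
    rw [← Finset.sum_subset (Finset.range_mono (Nat.succ_le_succ hNM))]
    · refine Finset.sum_congr rfl fun i hi => ?_
      rw [if_pos (Finset.mem_range.1 hi)]
    · intro i _ hi
      rw [if_neg (by simpa using hi)]
      simp
  intro t ht
  obtain ⟨f, rfl, N, a, ha, hf⟩ := hω t ht
  obtain ⟨g, rfl, M, b, hb, hg⟩ := hη t ht
  refine ⟨f + g, (add_smul _ _ _).symm, max N M,
    fun i => (if i < N + 1 then a i else 0) + (if i < M + 1 then b i else 0), by simp [ha, hb], ?_⟩
  have := add_mem (pad (max N M) (le_max_left _ _) hf) (pad (max N M) (le_max_right _ _) hg)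
  convert this using 1
  simp only [map_add, add_mul, Finset.sum_add_distrib]
  ring

theorem HasResidue.smul {P : Place K F} {ω : Ω[F⁄K]} {c : K} (k : K)
    (hω : P.HasResidue ω c) : P.HasResidue (k • ω) (k * c) := by
  intro t ht
  obtain ⟨f, rfl, N, a, ha, hf⟩ := hω t ht
  refine ⟨algebraMap K F k * f, by rw [mul_smul, algebraMap_smul], N, fun i => k * a i,
    by simp [ha], ?_⟩
  convert mul_mem (P.algebraMap_mem k) hf using 1
  simp only [map_mul, mul_sub, Finset.mul_sum, mul_assoc]

theorem HasResidue.zero (P : Place K F) : P.HasResidue (0 : Ω[F⁄K]) 0 :=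
  fun t _ => ⟨0, by simp, 0, 0, rfl, by simp⟩

theorem IsCartier.add {p : ℕ} [Fact p.Prime] [CharP F p] {ω η ω' η' : Ω[F⁄K]}
    (h : IsCartier p ω η) (h' : IsCartier p ω' η') : IsCartier p (ω + ω') (η + η') := by
  intro x hx
  obtain ⟨f, rfl, rfl⟩ := h x hx
  obtain ⟨g, rfl, rfl⟩ := h' x hx
  refine ⟨fun i => f i + g i, ?_, (add_smul _ _ _).symm⟩
  rw [← add_smul, ← Finset.sum_add_distrib]
  congr 1
  refine Finset.sum_congr rfl fun i _ => ?_
  rw [add_pow_char, add_mul]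

theorem IsCartier.smul {p : ℕ} {ω η : Ω[F⁄K]} (c : K)
    (h : IsCartier p ω η) : IsCartier p (c ^ p • ω) (c • η) := by
  intro x hx
  obtain ⟨f, rfl, rfl⟩ := h x hx
  refine ⟨fun i => algebraMap K F c * f i, ?_, by rw [mul_smul, algebraMap_smul]⟩
  simp only [mul_pow, mul_assoc, ← Finset.mul_sum]
  rw [mul_smul, ← map_pow, algebraMap_smul]

theorem IsCartier.zero {p : ℕ} [Fact p.Prime] : IsCartier p (0 : Ω[F⁄K]) 0 :=
  fun x _ => ⟨0, by simp [(Fact.out : p.Prime).ne_zero], by simp⟩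

theorem IsCartierIter.add {p : ℕ} [Fact p.Prime] [CharP F p] {e : ℕ} {ω η ω' η' : Ω[F⁄K]}
    (h : IsCartierIter p e ω η) (h' : IsCartierIter p e ω' η') :
    IsCartierIter p e (ω + ω') (η + η') := by
  induction e generalizing ω ω' with
  | zero => exact congrArg₂ (· + ·) h h'
  | succ e ih =>
    obtain ⟨ξ, h1, h2⟩ := h
    obtain ⟨ξ', h1', h2'⟩ := h'
    exact ⟨ξ + ξ', h1.add h1', ih h2 h2'⟩

theorem IsCartierIter.smul {p e : ℕ} {ω η : Ω[F⁄K]} (c : K)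
    (h : IsCartierIter p e ω η) : IsCartierIter p e (c ^ p ^ e • ω) (c • η) := by
  induction e generalizing ω with
  | zero => simpa [IsCartierIter] using congrArg (c • ·) h
  | succ e ih =>
    obtain ⟨ξ, h1, h2⟩ := h
    exact ⟨c ^ p ^ e • ξ, by simpa [pow_succ, pow_mul] using h1.smul (c ^ p ^ e), ih h2⟩

theorem IsCartierIter.zero {p : ℕ} [Fact p.Prime] (e : ℕ) :
    IsCartierIter p e (0 : Ω[F⁄K]) 0 := by
  induction e with
  | zero => rfl
  | succ e ih => exact ⟨0, IsCartier.zero, ih⟩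

/-- The code `Car_q(D, G)` over the field `k` with `q = pᵉ` elements, where `D = P₁ + ⋯ + Pₙ`: the
set of all `(res_{P₁}(ω), …, res_{Pₙ}(ω)) ∈ kⁿ` with `ω ∈ Ω(G - D)` and `𝒞_q(ω) = ω`, where
`𝒞_q = 𝒞ᵉ`. -/
def Car (p : ℕ) [Fact p.Prime] [CharP F p] {k : Type*} [Field k] [Algebra k K] {e : ℕ}
    (hk : Nat.card k = p ^ e) {n : ℕ} (P : Fin n → Place K F) (G : Divisor K F) :
    Submodule k (Fin n → k) where
  carrier := {c | ∃ ω ∈ Omega (G - Divisor.ofPoints P), IsCartierIter p e ω ω ∧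
    ∀ i, (P i).HasResidue ω (algebraMap k K (c i))}
  zero_mem' := ⟨0, zero_mem _, IsCartierIter.zero e, fun i => by
    simpa using HasResidue.zero (P i)⟩
  add_mem' := by
    rintro c d ⟨ω, hω, hC, hr⟩ ⟨η, hη, hC', hr'⟩
    exact ⟨ω + η, add_mem hω hη, hC.add hC', fun i => by
      simpa using HasResidue.add (hr i) (hr' i)⟩
  smul_mem' := by
    rintro a c ⟨ω, hω, hC, hr⟩
    refine ⟨algebraMap k K a • ω, Submodule.smul_mem _ _ hω, ?_, fun i => by
      simpa using HasResidue.smul (algebraMap k K a) (hr i)⟩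
    have hfin : Finite k := Nat.finite_of_card_ne_zero (by
      rw [hk]; exact pow_ne_zero _ (Fact.out : p.Prime).ne_zero)
    have := Fintype.ofFinite k
    have h := hC.smul (algebraMap k K a)
    rwa [← map_pow, ← hk, Nat.card_eq_fintype_card, FiniteField.pow_card] at h

end

end CartierCode

/-! The words of the code are produced from logarithmic forms, so no Riemann–Roch theorem and no
residue theorem is needed. Let E consist of the points P_i and the places of G^-, and let r = #E -
1. Finiteness of the class group over a finite constant field gives r functions with zeros and poles
in E only, multiplicatively independent modulo p-th powers (`exists_independent_units`). Their forms
dlog f_j have at most simple poles, all in E, so they lie in Ω(-(G^- + D)). They are fixed by the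
Cartier operator, and the independence modulo p-th powers makes them linearly independent over K
(`linearIndependent_dlog`). Take the r-dimensional F_q-space of combinations with coefficients in
F_q. These are still fixed by 𝒞_q, because c^q = c, and their residues, being combinations of
integers, lie in F_q. Membership in Ω(G - D) = Ω(-(G^- + D) + G^+) costs at most deg G^+ conditions
over K (`codimLE_Omega_add`), that is, ℓ deg G^+ over F_q. On what remains the residue map lands in
the code. A form in its kernel has no pole at any P_i, so it lies in Ω(G). A family independent over
F_q in the coefficient space gives forms independent over K, so this kernel has F_q-dimension at
most h^1(G). Subtracting gives r - ℓ deg G^+ - h^1(G), which is the bound (`card_le_finrank_Car`).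
The units require, for each Q, a nonconstant function with a pole at Q only. It comes from a
dimension count in which finiteness of the class group saves one condition at each step
(`exists_codimLE_scale`, `not_codimLE_bot_regularOn`). -/

namespace CartierCode

open KaehlerDifferential

/-! ### Differentials and p-th powers. -/

section Differentials

variable {K F : Type*} [Field K] [Field F] [Algebra K F]

theorem IsFunctionField.essFiniteType (hF : IsFunctionField K F) : Algebra.EssFiniteType K F := by
  obtain ⟨x, -, hfin⟩ := hF.exists_transcendental
  have h1 : Algebra.EssFiniteType K (IntermediateField.adjoin K {x}) :=
    IntermediateField.essFiniteType_iff.2 ⟨{x}, by simp⟩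
  exact Algebra.EssFiniteType.comp K (IntermediateField.adjoin K {x}) F

theorem IsFunctionField.exists_separating [PerfectField K] (hF : IsFunctionField K F) :
    ∃ x : F, Algebra.IsSeparable (IntermediateField.adjoin K {x}) F := by
  have := hF.essFiniteType
  obtain ⟨s, hs, hsep⟩ := exists_isTranscendenceBasis_and_isSeparable_of_perfectField K F
  obtain ⟨x, hx, hfin⟩ := hF.exists_transcendental
  have hx' : IsTranscendenceBasis K (fun _ : Unit => x) := by
    have hind : AlgebraicIndependent K (fun _ : Unit => x) :=
      algebraicIndependent_unique_type_iff.2 hx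
    refine hind.isTranscendenceBasis_iff_isAlgebraic.2 ?_
    have h1 : Set.range (fun _ : Unit => x) = {x} := by simp
    rw [h1]
    rw [← IntermediateField.isAlgebraic_adjoin_iff_top]
    infer_instance
  have hcard := hs.lift_cardinalMk_eq hx'
  have hc : s.card = 1 := by
    simpa using hcard
  obtain ⟨y, rfl⟩ := Finset.card_eq_one.1 hc
  rw [Finset.coe_singleton] at hsep
  exact ⟨y, hsep⟩

/-- Without differentials F would be unramified over K, hence finite over it, which a transcendental
element forbids. -/
theorem IsFunctionField.nontrivial_kaehler (hF : IsFunctionField K F) :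
    Nontrivial Ω[F⁄K] := by
  by_contra h
  rw [not_nontrivial_iff_subsingleton] at h
  have := hF.essFiniteType
  have : Algebra.FormallyUnramified K F := ⟨h⟩
  have := Algebra.FormallyUnramified.finite_of_free (R := K) (S := F)
  obtain ⟨x, hx, -⟩ := hF.exists_transcendental
  exact hx (Algebra.IsAlgebraic.isAlgebraic x)

variable (p : ℕ) [CharP F p]

theorem D_pow_char (g : F) : D K F (g ^ p) = 0 := by
  rw [Derivation.leibniz_pow, ← Nat.cast_smul_eq_nsmul F, CharP.cast_eq_zero, zero_smul]

/-- The derivative of a `p`-polynomial expansion. -/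
theorem D_sum_pow_mul_pow (g : ℕ → F) (x : F) (s : Finset ℕ) :
    D K F (∑ i ∈ s, g i ^ p * x ^ i) =
      (∑ i ∈ s, (i : F) * g i ^ p * x ^ (i - 1)) • D K F x := by
  rw [map_sum, Finset.sum_smul]
  refine Finset.sum_congr rfl fun i _ => ?_
  rw [Derivation.leibniz, D_pow_char p, smul_zero, add_zero, Derivation.leibniz_pow,
    ← Nat.cast_smul_eq_nsmul F, smul_smul, smul_smul]
  congr 1
  ring

variable [Fact p.Prime]

/-- Differentiating kills the p-th power coefficients and shortens the relation by one term. The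
factors i + 1 < p that appear are invertible and, being Frobenius-invariant, can be absorbed into
the p-th powers. -/
theorem eq_zero_of_sum_pow_mul_pow_eq_zero {x : F} (hx : D K F x ≠ 0) :
    ∀ m ≤ p, ∀ g : ℕ → F, ∑ i ∈ Finset.range m, g i ^ p * x ^ i = 0 → ∀ i < m, g i = 0 := by
  intro m
  induction m with
  | zero => intro _ _ _ i hi; omega
  | succ m ih =>
    intro hm g hg
    have hD := D_sum_pow_mul_pow (K := K) p g x (Finset.range (m + 1))
    rw [hg, map_zero] at hD
    have h0 := (smul_eq_zero.1 hD.symm).resolve_right hx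
    rw [Finset.sum_range_succ'] at h0
    simp only [Nat.cast_zero, zero_mul, add_zero, Nat.add_sub_cancel] at h0
    have hcast : ∀ i : ℕ, ((i : F)) ^ p = i := fun i => by
      rw [← frobenius_def, map_natCast]
    have h1 := ih (by omega) (fun i => ((i + 1 : ℕ) : F) * g (i + 1)) (by
      rw [← h0]
      refine Finset.sum_congr rfl fun i _ => ?_
      rw [mul_pow, hcast])
    have h2 : ∀ i < m, g (i + 1) = 0 := by
      intro i hi
      refine (mul_eq_zero.1 (h1 i hi)).resolve_left ?_
      rw [CharP.cast_eq_zero_iff F p]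
      exact Nat.not_dvd_of_pos_of_lt (by omega) (by omega)
    have h3 : g 0 = 0 := by
      rw [Finset.sum_range_succ', Finset.sum_eq_zero, zero_add] at hg
      · simpa [(Fact.out : p.Prime).ne_zero] using hg
      · intro i hi
        rw [h2 i (Finset.mem_range.1 hi), zero_pow (Fact.out : p.Prime).ne_zero, zero_mul]
    rintro (_ | i) hi
    · exact h3
    · exact h2 i (by omega)

/-- Expansion of all elements in powers of a separating element, with `p`-th power coefficients. -/
theorem exists_sum_pow_mul_pow_of_isSeparable [PerfectField K] (x : F)
    [Algebra.IsSeparable (IntermediateField.adjoin K {x}) F] (y : F) :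
    ∃ g : ℕ → F, y = ∑ i ∈ Finset.range p, g i ^ p * x ^ i := by
  have hp : p.Prime := Fact.out
  have : CharP K p := (algebraMap K F).charP (algebraMap K F).injective p
  have : ExpChar K p := .prime hp
  have : ExpChar F p := .prime hp
  let L : Subfield F := (frobenius F p).fieldRange
  have hpowL : ∀ z : F, z ^ p ∈ L := fun z => ⟨z, rfl⟩
  have hexp : ExpChar (IntermediateField.adjoin K {x}) p :=
    expChar_of_injective_algebraMap (algebraMap K (IntermediateField.adjoin K {x})).injective p
  -- Separability over K(x) means that K(x) and F^p together generate F. As K is perfect, K lies in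
  -- L = F^p, so F = F^p(x).
  have htop := IntermediateField.adjoin_eq_adjoin_pow_expChar_of_isSeparable'
    (IntermediateField.adjoin K {x}) F (S := (Set.univ : Set F)) p
  have hy : y ∈ IntermediateField.adjoin (IntermediateField.adjoin K {x})
      ((· ^ p) '' (Set.univ : Set F)) := by
    rw [← htop]; exact IntermediateField.subset_adjoin _ _ (Set.mem_univ y)
  have hxM : x ∈ (IntermediateField.adjoin L {x}) := IntermediateField.mem_adjoin_simple_self L x
  have hLM : ∀ z ∈ L, z ∈ IntermediateField.adjoin L {x} := fun z hz =>
    (IntermediateField.adjoin L {x}).algebraMap_mem ⟨z, hz⟩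
  have hKM : ∀ c : K, algebraMap K F c ∈ IntermediateField.adjoin L {x} := by
    intro c
    apply hLM
    obtain ⟨d, rfl⟩ := (PerfectRing.bijective_frobenius (R := K) (p := p)).2 c
    change algebraMap K F (d ^ p) ∈ L
    rw [map_pow]
    exact hpowL _
  have hle1 : ∀ z ∈ IntermediateField.adjoin K {x}, z ∈ IntermediateField.adjoin L {x} := by
    intro z hz
    have : (Subfield.closure (Set.range (algebraMap K F) ∪ {x})) ≤
        (IntermediateField.adjoin L {x}).toSubfield := by
      rw [Subfield.closure_le]
      rintro _ (⟨c, rfl⟩ | rfl)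
      · exact hKM c
      · exact hxM
    exact this hz
  have hyM : y ∈ IntermediateField.adjoin L {x} := by
    have : (Subfield.closure (Set.range (algebraMap (IntermediateField.adjoin K {x}) F) ∪
        ((· ^ p) '' (Set.univ : Set F)))) ≤ (IntermediateField.adjoin L {x}).toSubfield := by
      rw [Subfield.closure_le]
      rintro _ (⟨c, rfl⟩ | ⟨z, -, rfl⟩)
      · exact hle1 _ c.2
      · exact hLM _ (hpowL z)
    exact this hy
  -- Since x is a root of X^p - x^p over F^p, division by this polynomial leaves only powers of x
  -- below p.
  let a : L := ⟨x ^ p, hpowL x⟩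
  have hmonic : (Polynomial.X ^ p - Polynomial.C a).Monic :=
    Polynomial.monic_X_pow_sub_C a hp.ne_zero
  have hroot : Polynomial.aeval x (Polynomial.X ^ p - Polynomial.C a) = 0 := by
    simp only [map_sub, map_pow, Polynomial.aeval_X, Polynomial.aeval_C]
    exact sub_self _
  have hintegral : IsIntegral L x := ⟨_, hmonic, hroot⟩
  have hyA : y ∈ Algebra.adjoin L {x} := by
    rw [← IntermediateField.adjoin_simple_toSubalgebra_of_isAlgebraic hintegral.isAlgebraic]
    exact hyM
  rw [Algebra.adjoin_singleton_eq_range_aeval] at hyA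
  obtain ⟨f, rfl⟩ := hyA
  have hdiv := Polynomial.modByMonic_add_div f (Polynomial.X ^ p - Polynomial.C a)
  set r := f %ₘ (Polynomial.X ^ p - Polynomial.C a) with hr
  have hdeg : r.natDegree < p := by
    have := Polynomial.natDegree_modByMonic_lt f hmonic (by
      intro h
      have := congrArg Polynomial.natDegree h
      rw [Polynomial.natDegree_X_pow_sub_C, Polynomial.natDegree_one] at this
      exact hp.ne_zero this)
    rwa [Polynomial.natDegree_X_pow_sub_C] at this
  have heval : Polynomial.aeval x f = Polynomial.aeval x r := by
    conv_lhs => rw [← hdiv]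
    rw [map_add, map_mul, hroot, zero_mul, add_zero]
  have hg : ∀ z : L, ∃ w : F, w ^ p = z := fun z => z.2
  choose g hg using hg
  refine ⟨fun i => g (r.coeff i), ?_⟩
  change Polynomial.aeval x f = _
  rw [heval, Polynomial.aeval_eq_sum_range' hdeg]
  refine Finset.sum_congr rfl fun i _ => ?_
  rw [hg, Algebra.smul_def]
  rfl

end Differentials

/-! ### Separating elements: those with nonzero differential. -/

section Separating

variable {K F : Type*} [Field K] [Field F] [Algebra K F]

theorem exists_smul_D_of_forall {x : F} (h : ∀ y : F, ∃ c : F, D K F y = c • D K F x)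
    (ω : Ω[F⁄K]) : ∃ c : F, ω = c • D K F x := by
  have hω : ω ∈ Submodule.span F (Set.range (D K F)) := by
    rw [span_range_derivation]; trivial
  have hle : Submodule.span F (Set.range (D K F)) ≤ Submodule.span F {D K F x} := by
    rw [Submodule.span_le]
    rintro _ ⟨y, rfl⟩
    obtain ⟨c, hc⟩ := h y
    exact Submodule.mem_span_singleton.2 ⟨c, hc.symm⟩
  obtain ⟨c, hc⟩ := Submodule.mem_span_singleton.1 (hle hω)
  exact ⟨c, hc.symm⟩

variable (p : ℕ) [CharP F p] [Fact p.Prime]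

/-- There is an element whose powers expand all elements and whose differential spans. -/
theorem IsFunctionField.exists_expansion [PerfectField K] (hF : IsFunctionField K F) :
    ∃ x : F, D K F x ≠ 0 ∧
      ∀ y : F, ∃ g : ℕ → F, y = ∑ i ∈ Finset.range p, g i ^ p * x ^ i := by
  obtain ⟨x, hsep⟩ := hF.exists_separating
  have hexp := exists_sum_pow_mul_pow_of_isSeparable (K := K) p x
  refine ⟨x, fun hx => ?_, hexp⟩
  have := hF.nontrivial_kaehler
  obtain ⟨ω, hω⟩ := exists_ne (0 : Ω[F⁄K])
  obtain ⟨c, hc⟩ := exists_smul_D_of_forall (x := x) (fun y => by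
    obtain ⟨g, hg⟩ := hexp y
    exact ⟨_, by rw [hg, D_sum_pow_mul_pow]⟩) ω
  exact hω (by rw [hc, hx, smul_zero])

/-- One good element x₀ shows [F : F^p] ≤ p. For any x with dx ≠ 0 the powers 1, x, ..., x^(p-1) are
independent over F^p, so they form a basis. -/
theorem IsFunctionField.exists_sum_pow_mul_pow [PerfectField K] (hF : IsFunctionField K F)
    {x : F} (hx : D K F x ≠ 0) (y : F) :
    ∃ g : ℕ → F, y = ∑ i ∈ Finset.range p, g i ^ p * x ^ i := by
  obtain ⟨x₀, hx₀, hexp⟩ := hF.exists_expansion p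
  let L : Subfield F := (frobenius F p).fieldRange
  have hpowL : ∀ z : F, z ^ p ∈ L := fun z => ⟨z, rfl⟩
  have hroot : ∀ z : L, ∃ w : F, w ^ p = z := fun z => z.2
  choose root hroot using hroot
  have hspan : (⊤ : Submodule L F) ≤ Submodule.span L (Set.range fun i : Fin p => x₀ ^ (i : ℕ)) := by
    intro y _
    obtain ⟨g, hg⟩ := hexp y
    rw [hg, Finset.sum_range]
    refine Submodule.sum_mem _ fun i _ => ?_
    exact Submodule.smul_mem _ (⟨g i ^ p, hpowL _⟩ : L) (Submodule.subset_span ⟨i, rfl⟩)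
  have hfin : Module.Finite L F :=
    ⟨⟨(Set.finite_range fun i : Fin p => x₀ ^ (i : ℕ)).toFinset, by
      simpa using top_le_iff.1 hspan⟩⟩
  have hrank : Module.finrank L F ≤ p := by
    have := finrank_range_le_card (R := L) (fun i : Fin p => x₀ ^ (i : ℕ))
    rwa [Set.finrank, top_le_iff.1 hspan, finrank_top, Fintype.card_fin] at this
  have hli : LinearIndependent L (fun i : Fin p => x ^ (i : ℕ)) := by
    rw [Fintype.linearIndependent_iff]
    intro c hc i
    let g : ℕ → F := fun j => if h : j < p then root (c ⟨j, h⟩) else 0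
    have := eq_zero_of_sum_pow_mul_pow_eq_zero (K := K) p hx p le_rfl g (by
      rw [Finset.sum_range, ← hc]
      refine Finset.sum_congr rfl fun j _ => ?_
      simp only [g, j.2, dite_true, Fin.eta, hroot]
      rfl) i i.2
    simp only [g, i.2, dite_true, Fin.eta] at this
    have h2 := hroot (c i)
    rw [this, zero_pow (Fact.out : p.Prime).ne_zero] at h2
    exact Subtype.ext h2.symm
  have hcard : Fintype.card (Fin p) = Module.finrank L F :=
    le_antisymm hli.fintype_card_le_finrank (by simpa using hrank)
  have : Nonempty (Fin p) := ⟨⟨0, (Fact.out : p.Prime).pos⟩⟩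
  have htop := hli.span_eq_top_of_card_eq_finrank hcard
  have hy : y ∈ Submodule.span L (Set.range fun i : Fin p => x ^ (i : ℕ)) := by
    rw [htop]; trivial
  obtain ⟨c, hc⟩ := (Submodule.mem_span_range_iff_exists_fun L).1 hy
  refine ⟨fun j => if h : j < p then root (c ⟨j, h⟩) else 0, ?_⟩
  rw [Finset.sum_range, ← hc]
  refine Finset.sum_congr rfl fun j _ => ?_
  simp only [j.2, dite_true, Fin.eta, hroot]
  rfl

theorem IsFunctionField.exists_smul_D (p : ℕ) [CharP F p] [Fact p.Prime] [PerfectField K] (hF : IsFunctionField K F)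
    {x : F} (hx : D K F x ≠ 0) (ω : Ω[F⁄K]) : ∃ c : F, ω = c • D K F x :=
  exists_smul_D_of_forall (fun y => by
    obtain ⟨g, hg⟩ := hF.exists_sum_pow_mul_pow p hx y
    exact ⟨_, by rw [hg, D_sum_pow_mul_pow]⟩) ω

/-- In the expansion of f the derivative sees every coefficient but the zeroth, so df = 0 leaves
only the term `g 0 ^ p`. -/
theorem IsFunctionField.eq_pow_of_D_eq_zero [PerfectField K] (hF : IsFunctionField K F)
    {f : F} (hf : D K F f = 0) : ∃ g : F, f = g ^ p := by
  obtain ⟨x, hx, hexp⟩ := hF.exists_expansion p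
  obtain ⟨g, hg⟩ := hexp f
  have hp : p.Prime := Fact.out
  have hcast : ∀ i : ℕ, ((i : F)) ^ p = i := fun i => by
    rw [← frobenius_def, map_natCast]
  obtain ⟨m, hm⟩ : ∃ m, p = m + 1 := ⟨p - 1, by have := hp.pos; omega⟩
  have h0 : ∑ i ∈ Finset.range m, (((i + 1 : ℕ) : F) * g (i + 1)) ^ p * x ^ i = 0 := by
    rw [hg, D_sum_pow_mul_pow] at hf
    have := (smul_eq_zero.1 hf).resolve_right hx
    rw [hm, Finset.sum_range_succ'] at this
    rw [← hm] at this
    simpa [mul_pow, hcast, -Nat.cast_add] using this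
  have h1 := eq_zero_of_sum_pow_mul_pow_eq_zero (K := K) p hx m (by omega) _ h0
  refine ⟨g 0, ?_⟩
  rw [hg]
  conv_lhs => rw [hm, Finset.sum_range_succ']
  rw [← hm, Finset.sum_eq_zero, zero_add, pow_zero, mul_one]
  intro i hi
  have hi := Finset.mem_range.1 hi
  have : g (i + 1) = 0 := by
    refine (mul_eq_zero.1 (h1 i hi)).resolve_left ?_
    rw [CharP.cast_eq_zero_iff F p]
    exact Nat.not_dvd_of_pos_of_lt (by omega) (by omega)
  rw [this, zero_pow hp.ne_zero, zero_mul]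

/-- The differentials of F over K(x) are a quotient of those over K, which dx spans, and dx becomes
zero in the quotient. -/
theorem IsFunctionField.formallyUnramified_adjoin (p : ℕ) [CharP F p] [Fact p.Prime] [PerfectField K] (hF : IsFunctionField K F)
    {x : F} (hx : D K F x ≠ 0) :
    Algebra.FormallyUnramified (IntermediateField.adjoin K {x}) F := by
  constructor
  refine subsingleton_of_forall_eq 0 fun η => ?_
  obtain ⟨ω, rfl⟩ := KaehlerDifferential.map_surjective K (IntermediateField.adjoin K {x}) F η
  obtain ⟨c, rfl⟩ := hF.exists_smul_D p hx ω
  rw [map_smul, KaehlerDifferential.map_D]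
  have h : D (IntermediateField.adjoin K {x}) F (algebraMap F F x) = 0 :=
    (D (IntermediateField.adjoin K {x}) F).map_algebraMap
      ⟨x, IntermediateField.mem_adjoin_simple_self K x⟩
  rw [h, smul_zero]

theorem IsFunctionField.finite_adjoin (p : ℕ) [CharP F p] [Fact p.Prime] [PerfectField K] (hF : IsFunctionField K F)
    {x : F} (hx : D K F x ≠ 0) :
    Module.Finite (IntermediateField.adjoin K {x}) F := by
  have := hF.essFiniteType
  have := hF.formallyUnramified_adjoin p hx
  have := Algebra.EssFiniteType.of_comp K (IntermediateField.adjoin K {x}) F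
  exact Algebra.FormallyUnramified.finite_of_free (R := IntermediateField.adjoin K {x}) (S := F)

theorem IsFunctionField.isSeparable_adjoin (p : ℕ) [CharP F p] [Fact p.Prime] [PerfectField K] (hF : IsFunctionField K F)
    {x : F} (hx : D K F x ≠ 0) :
    Algebra.IsSeparable (IntermediateField.adjoin K {x}) F := by
  have := hF.essFiniteType
  have := hF.formallyUnramified_adjoin p hx
  have := Algebra.EssFiniteType.of_comp K (IntermediateField.adjoin K {x}) F
  exact Algebra.FormallyUnramified.isSeparable _ _

theorem IsFunctionField.transcendental_of_D_ne_zero (hF : IsFunctionField K F)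
    {x : F} (hx : D K F x ≠ 0) : Transcendental K x := by
  intro h
  obtain ⟨c, rfl⟩ := hF.full_constant_field x h
  exact hx ((D K F).map_algebraMap c)

end Separating

/-! ### The Cartier operator and logarithmic forms. -/

section CartierOperator

variable {K F : Type*} [Field K] [Field F] [Algebra K F]

/-- `η` is the image of `ω` under the Cartier operator computed with the coordinate `x`. -/
def IsCartierAt (p : ℕ) (x : F) (ω η : Ω[F⁄K]) : Prop :=
  ∃ f : ℕ → F,
    ω = (∑ i ∈ Finset.range p, f i ^ p * x ^ i) • D K F x ∧ η = f (p - 1) • D K F x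

variable {p : ℕ} [CharP F p] [Fact p.Prime]

theorem IsCartierAt.add {x : F} {ω η ω' η' : Ω[F⁄K]}
    (h : IsCartierAt p x ω η) (h' : IsCartierAt p x ω' η') :
    IsCartierAt p x (ω + ω') (η + η') := by
  obtain ⟨f, rfl, rfl⟩ := h
  obtain ⟨g, rfl, rfl⟩ := h'
  refine ⟨fun i => f i + g i, ?_, (add_smul _ _ _).symm⟩
  rw [← add_smul, ← Finset.sum_add_distrib]
  congr 1
  refine Finset.sum_congr rfl fun i _ => ?_
  rw [add_pow_char, add_mul]

theorem IsCartierAt.zero {p : ℕ} [Fact p.Prime] (x : F) : IsCartierAt p x (0 : Ω[F⁄K]) 0 :=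
  ⟨0, by simp [(Fact.out : p.Prime).ne_zero], by simp⟩

theorem IsCartierAt.sum {x : F} {ι : Type*} (s : Finset ι) {ω η : ι → Ω[F⁄K]}
    (h : ∀ i ∈ s, IsCartierAt p x (ω i) (η i)) :
    IsCartierAt p x (∑ i ∈ s, ω i) (∑ i ∈ s, η i) := by
  classical
  induction s using Finset.induction_on with
  | empty => simpa using IsCartierAt.zero x
  | insert i s hi ih =>
    rw [Finset.sum_insert hi, Finset.sum_insert hi]
    exact (h i (Finset.mem_insert_self i s)).add
      (ih fun j hj => h j (Finset.mem_insert_of_mem hj))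

theorem IsCartierAt.smul {p : ℕ} {x : F} {ω η : Ω[F⁄K]} (c : F) (h : IsCartierAt p x ω η) :
    IsCartierAt p x (c ^ p • ω) (c • η) := by
  obtain ⟨f, rfl, rfl⟩ := h
  refine ⟨fun i => c * f i, ?_, by rw [mul_smul]⟩
  simp only [mul_pow, mul_assoc, ← Finset.mul_sum]
  rw [mul_smul]

theorem IsCartierAt.eq_zero {x : F} (hx : D K F x ≠ 0) {η : Ω[F⁄K]}
    (h : IsCartierAt p x 0 η) : η = 0 := by
  obtain ⟨f, h0, rfl⟩ := h
  have hp : p.Prime := Fact.out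
  have := eq_zero_of_sum_pow_mul_pow_eq_zero (K := K) p hx p le_rfl f
    ((smul_eq_zero.1 h0.symm).resolve_right hx) (p - 1) (by have := hp.pos; omega)
  rw [this, zero_smul]

/-- The Cartier operator kills exact forms. -/
theorem IsFunctionField.isCartierAt_D [PerfectField K] (hF : IsFunctionField K F)
    {x : F} (hx : D K F x ≠ 0) (h : F) : IsCartierAt p x (D K F h) 0 := by
  obtain ⟨g, rfl⟩ := hF.exists_sum_pow_mul_pow p hx h
  have hp : p.Prime := Fact.out
  have hcast : ∀ i : ℕ, ((i : F)) ^ p = i := fun i => by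
    rw [← frobenius_def, map_natCast]
  obtain ⟨m, hm⟩ : ∃ m, p = m + 1 := ⟨p - 1, by have := hp.pos; omega⟩
  -- These are the coefficients of the derivative. At i = p - 1 the factor i + 1 is p = 0, which is
  -- why the Cartier image vanishes.
  refine ⟨fun i => ((i + 1 : ℕ) : F) * g (i + 1), ?_, ?_⟩
  · rw [D_sum_pow_mul_pow]
    congr 1
    have h1 : ∑ i ∈ Finset.range p, (i : F) * g i ^ p * x ^ (i - 1) =
        ∑ i ∈ Finset.range m, ((i + 1 : ℕ) : F) * g (i + 1) ^ p * x ^ i := by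
      conv_lhs => rw [hm, Finset.sum_range_succ']
      simp [← hm]
    have h2 : ∑ i ∈ Finset.range p, (((i + 1 : ℕ) : F) * g (i + 1)) ^ p * x ^ i =
        ∑ i ∈ Finset.range m, ((i + 1 : ℕ) : F) * g (i + 1) ^ p * x ^ i := by
      conv_lhs => rw [hm, Finset.sum_range_succ]
      simp only [← hm, mul_pow, hcast]
      simp
    rw [h1, h2]
  · have : p - 1 + 1 = p := by have := hp.pos; omega
    simp [this]

/-- The map `f ↦ f ^ (p - 1) df` is additive modulo exact forms. -/
theorem exists_D_eq_pow_smul_D_add {p : ℕ} [Fact p.Prime] (f g : F) : ∃ H : F,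
    (f + g) ^ (p - 1) • D K F (f + g) =
      f ^ (p - 1) • D K F f + g ^ (p - 1) • D K F g + D K F H := by
  have hp : p.Prime := Fact.out
  obtain ⟨m, rfl⟩ : ∃ m, p = m + 1 := ⟨p - 1, by have := hp.pos; omega⟩
  -- With p = m + 1, the primitive H is ((f + g)^p - f^p - g^p)/p, which has integer coefficients.
  -- The two identities for `c` compute its partial derivatives.
  let c : ℕ → ℕ := fun i => (m + 1).choose (i + 1) / (m + 1)
  have hc1 : ∀ i < m, c i * (i + 1) = m.choose i := by
    intro i hi
    have hd : (m + 1) ∣ (m + 1).choose (i + 1) := hp.dvd_choose_self (by omega) (by omega)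
    have h1 : (m + 1) * c i = (m + 1).choose (i + 1) := Nat.mul_div_cancel' hd
    have h2 := Nat.add_one_mul_choose_eq m i
    have : (m + 1) * (c i * (i + 1)) = (m + 1) * m.choose i := by
      rw [h2, ← h1]; ring
    exact Nat.eq_of_mul_eq_mul_left (by omega) this
  have hc2 : ∀ i < m, c i * (m - i) = m.choose (i + 1) := by
    intro i hi
    have h2 := Nat.choose_succ_right_eq m i
    have h3 := hc1 i hi
    have : (i + 1) * (c i * (m - i)) = (i + 1) * m.choose (i + 1) := by
      calc (i + 1) * (c i * (m - i)) = (c i * (i + 1)) * (m - i) := by ring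
        _ = m.choose i * (m - i) := by rw [h3]
        _ = _ := by rw [← h2]; ring
    exact Nat.eq_of_mul_eq_mul_left (by omega) this
  refine ⟨∑ i ∈ Finset.range m, (c i : F) * (f ^ (i + 1) * g ^ (m - i)), ?_⟩
  have hD : D K F (∑ i ∈ Finset.range m, (c i : F) * (f ^ (i + 1) * g ^ (m - i))) =
      (∑ i ∈ Finset.range m, (m.choose i : F) * f ^ i * g ^ (m - i)) • D K F f +
      (∑ i ∈ Finset.range m, (m.choose (i + 1) : F) * f ^ (i + 1) * g ^ (m - (i + 1))) •
        D K F g := by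
    rw [map_sum, Finset.sum_smul, Finset.sum_smul, ← Finset.sum_add_distrib]
    refine Finset.sum_congr rfl fun i hi => ?_
    have hi := Finset.mem_range.1 hi
    rw [← nsmul_eq_mul, map_nsmul, Derivation.leibniz, Derivation.leibniz_pow,
      Derivation.leibniz_pow, ← hc1 i hi, ← hc2 i hi]
    simp only [← Nat.cast_smul_eq_nsmul F, smul_smul, smul_add]
    rw [add_comm]
    have e1 : i + 1 - 1 = i := by omega
    have e2 : m - i - 1 = m - (i + 1) := by omega
    rw [e1, e2]
    congr 2 <;> push_cast <;> ring
  have hs1 : (f + g) ^ m = (∑ i ∈ Finset.range m, (m.choose i : F) * f ^ i * g ^ (m - i)) +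
      f ^ m := by
    rw [add_pow, Finset.sum_range_succ]
    simp only [Nat.choose_self, Nat.cast_one, mul_one, Nat.sub_self, pow_zero]
    congr 1
    exact Finset.sum_congr rfl fun i _ => by ring
  have hs2 : (f + g) ^ m =
      (∑ i ∈ Finset.range m, (m.choose (i + 1) : F) * f ^ (i + 1) * g ^ (m - (i + 1))) +
      g ^ m := by
    rw [add_pow, Finset.sum_range_succ']
    simp only [pow_zero, Nat.choose_zero_right, Nat.cast_one, mul_one, one_mul, Nat.sub_zero]
    congr 1
    exact Finset.sum_congr rfl fun i _ => by ring
  rw [hD, Nat.add_sub_cancel, map_add, smul_add]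
  conv_lhs => rw [hs1]
  conv_lhs => arg 2; rw [← hs1, hs2]
  simp only [add_smul]
  abel

/-- Modulo exact forms, which the operator kills, both sides are additive in f. It is therefore
enough to check the monomials a^p x^i. -/
theorem IsFunctionField.isCartierAt_pow_smul_D [PerfectField K] (hF : IsFunctionField K F)
    {x : F} (hx : D K F x ≠ 0) (f : F) :
    IsCartierAt p x (f ^ (p - 1) • D K F f) (D K F f) := by
  have hp : p.Prime := Fact.out
  have hcast : ∀ i : ℕ, ((i : F)) ^ p = i := fun i => by
    rw [← frobenius_def, map_natCast]
  have hp1 : p - 1 + 1 = p := by have := hp.pos; omega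
  have hmon : ∀ (a : F) (i : ℕ), IsCartierAt p x
      ((a ^ p * x ^ i) ^ (p - 1) • D K F (a ^ p * x ^ i)) (D K F (a ^ p * x ^ i)) := by
    intro a i
    have hD : D K F (a ^ p * x ^ i) = ((i : F) * a ^ p * x ^ (i - 1)) • D K F x := by
      simpa using D_sum_pow_mul_pow (K := K) p (fun _ => a) x {i}
    have hbase : IsCartierAt p x (x ^ (p - 1) • D K F x) (D K F x) := by
      refine ⟨fun j => if j = p - 1 then 1 else 0, ?_, by simp⟩
      rw [Finset.sum_eq_single_of_mem (p - 1) (Finset.mem_range.2 (by omega))]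
      · simp
      · intro j _ hj
        simp [hj, hp.ne_zero]
    have := hbase.smul ((i : F) * a ^ p * x ^ (i - 1))
    rw [hD]
    convert this using 1
    rw [smul_smul, smul_smul]
    congr 1
    rcases Nat.eq_zero_or_pos i with rfl | hi
    · simp [hp.ne_zero]
    · obtain ⟨j, rfl⟩ : ∃ j, i = j + 1 := ⟨i - 1, by omega⟩
      rw [Nat.add_sub_cancel]
      simp only [mul_pow, hcast]
      obtain ⟨m, rfl⟩ : ∃ m, p = m + 1 := ⟨p - 1, by omega⟩
      rw [Nat.add_sub_cancel]
      push_cast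
      ring
  have hsum : ∀ (s : Finset ℕ) (g : ℕ → F), IsCartierAt p x
      ((∑ i ∈ s, g i ^ p * x ^ i) ^ (p - 1) • D K F (∑ i ∈ s, g i ^ p * x ^ i))
      (D K F (∑ i ∈ s, g i ^ p * x ^ i)) := by
    intro s g
    classical
    induction s using Finset.induction_on with
    | empty => simpa using IsCartierAt.zero x
    | insert i s hi ih =>
      rw [Finset.sum_insert hi]
      obtain ⟨H, hH⟩ := exists_D_eq_pow_smul_D_add (K := K) (p := p) (g i ^ p * x ^ i)
        (∑ i ∈ s, g i ^ p * x ^ i)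
      rw [hH, map_add]
      simpa using ((hmon (g i) i).add ih).add (hF.isCartierAt_D hx H)
  obtain ⟨g, rfl⟩ := hF.exists_sum_pow_mul_pow p hx f
  exact hsum _ g

variable (K) in
/-- The logarithmic differential `df / f`. -/
noncomputable def dlog (f : F) : Ω[F⁄K] := f⁻¹ • D K F f

/-- Logarithmic forms are fixed by the Cartier operator. -/
theorem IsFunctionField.isCartier_dlog [PerfectField K] (hF : IsFunctionField K F)
    {f : F} (hf : f ≠ 0) : IsCartier p (dlog K f) (dlog K f) := by
  intro x hx
  have := (hF.isCartierAt_pow_smul_D (p := p) hx f).smul f⁻¹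
  rw [smul_smul] at this
  have hp : p.Prime := Fact.out
  have e : f⁻¹ ^ p * f ^ (p - 1) = f⁻¹ := by
    obtain ⟨m, hm⟩ : ∃ m, p = m + 1 := ⟨p - 1, by have := hp.pos; omega⟩
    rw [hm, Nat.add_sub_cancel, pow_succ, mul_right_comm, ← mul_pow, inv_mul_cancel₀ hf, one_pow,
      one_mul]
  rw [e] at this
  exact this

theorem dlog_mul {f g : F} (hf : f ≠ 0) (hg : g ≠ 0) :
    dlog K (f * g) = dlog K f + dlog K g := by
  rw [dlog, Derivation.leibniz, smul_add, smul_smul, smul_smul, add_comm, dlog, dlog]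
  congr 2 <;> field_simp

theorem dlog_one : dlog K (1 : F) = 0 := by
  rw [dlog, Derivation.map_one_eq_zero, smul_zero]

theorem dlog_inv {f : F} (hf : f ≠ 0) : dlog K f⁻¹ = - dlog K f := by
  have := dlog_mul (K := K) hf (inv_ne_zero hf)
  rw [mul_inv_cancel₀ hf, dlog_one] at this
  exact (neg_eq_of_add_eq_zero_right this.symm).symm

theorem dlog_pow {f : F} (hf : f ≠ 0) (n : ℕ) : dlog K (f ^ n) = n • dlog K f := by
  induction n with
  | zero => simp [dlog_one]
  | succ n ih => rw [pow_succ, dlog_mul (pow_ne_zero n hf) hf, ih, succ_nsmul]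

theorem dlog_zpow {f : F} (hf : f ≠ 0) (n : ℤ) : dlog K (f ^ n) = n • dlog K f := by
  cases n with
  | ofNat n => simpa using dlog_pow hf n
  | negSucc n =>
    rw [zpow_negSucc, dlog_inv (pow_ne_zero _ hf), dlog_pow hf, negSucc_zsmul]

theorem dlog_prod {ι : Type*} (s : Finset ι) (f : ι → F) (hf : ∀ i ∈ s, f i ≠ 0) :
    dlog K (∏ i ∈ s, f i) = ∑ i ∈ s, dlog K (f i) := by
  classical
  induction s using Finset.induction_on with
  | empty => simp [dlog_one]
  | insert i s hi ih =>
    rw [Finset.prod_insert hi, Finset.sum_insert hi, dlog_mul (hf i (Finset.mem_insert_self i s))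
      (Finset.prod_ne_zero_iff.2 fun j hj => hf j (Finset.mem_insert_of_mem hj)),
      ih fun j hj => hf j (Finset.mem_insert_of_mem hj)]

end CartierOperator

/-! ### Orders at places and local expansions. -/

section Places

variable {K F : Type*} [Field K] [Field F] [Algebra K F] (P : Place K F)

theorem Place.val_le_one_iff {f : F} : P.val f ≤ 1 ↔ f ∈ P.ring := by
  constructor
  · intro h
    obtain ⟨a, rfl⟩ := IsDiscreteValuationRing.exists_lift_of_le_one (A := P.ring) h
    exact a.2
  · intro h
    exact IsDedekindDomain.HeightOneSpectrum.valuation_le_one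
      (IsDiscreteValuationRing.maximalIdeal P.ring) ⟨f, h⟩

theorem Place.exists_isUniformizer : ∃ t, P.IsUniformizer t :=
  IsDedekindDomain.HeightOneSpectrum.valuation_exists_uniformizer F _

/-- The order of vanishing at `P`, with the value `0` at `f = 0`. -/
noncomputable def Place.ord (f : F) : ℤ := - WithZero.log (P.val f)

variable {P}

theorem Place.val_eq_exp {f : F} (hf : f ≠ 0) : P.val f = WithZero.exp (- P.ord f) := by
  rw [Place.ord, neg_neg, WithZero.exp_log ((Valuation.ne_zero_iff _).2 hf)]

theorem Place.val_le_exp_iff {f : F} (hf : f ≠ 0) (m : ℤ) :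
    P.val f ≤ WithZero.exp (-m) ↔ m ≤ P.ord f := by
  rw [Place.val_eq_exp hf, WithZero.exp_le_exp, neg_le_neg_iff]

theorem Place.ord_mul {f g : F} (hf : f ≠ 0) (hg : g ≠ 0) :
    P.ord (f * g) = P.ord f + P.ord g := by
  rw [Place.ord, map_mul, WithZero.log_mul ((Valuation.ne_zero_iff _).2 hf)
    ((Valuation.ne_zero_iff _).2 hg), neg_add]
  rfl

theorem Place.ord_one : P.ord (1 : F) = 0 := by simp [Place.ord]

theorem Place.ord_inv (f : F) : P.ord f⁻¹ = - P.ord f := by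
  rw [Place.ord, map_inv₀, WithZero.log_inv]; rfl

theorem Place.ord_pow (f : F) (n : ℕ) : P.ord (f ^ n) = n * P.ord f := by
  rw [Place.ord, map_pow, WithZero.log_pow, Place.ord]; simp

theorem Place.ord_zpow (f : F) (n : ℤ) : P.ord (f ^ n) = n * P.ord f := by
  rw [Place.ord, map_zpow₀, WithZero.log_zpow, Place.ord]; simp

theorem Place.mem_ring_iff {f : F} (hf : f ≠ 0) : f ∈ P.ring ↔ 0 ≤ P.ord f := by
  rw [← P.val_le_one_iff, ← Place.val_le_exp_iff hf 0]; simp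

theorem Place.isUniformizer_iff {t : F} : P.IsUniformizer t ↔ P.ord t = 1 := by
  constructor
  · intro h
    rw [Place.ord, h, WithZero.log_exp]; rfl
  · intro h
    have ht : t ≠ 0 := by rintro rfl; simp [Place.ord] at h
    rw [Place.IsUniformizer, Place.val_eq_exp ht, h]

theorem Place.IsUniformizer.ne_zero {t : F} (ht : P.IsUniformizer t) : t ≠ 0 := by
  rintro rfl
  rw [Place.isUniformizer_iff] at ht
  simp [Place.ord] at ht

theorem Place.IsUniformizer.mem_ring {t : F} (ht : P.IsUniformizer t) : t ∈ P.ring := by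
  rw [Place.mem_ring_iff ht.ne_zero, Place.isUniformizer_iff.1 ht]
  norm_num

theorem Place.ord_eq_zero_of_mem_of_inv_mem {f : F} (hf : f ∈ P.ring) (hf' : f⁻¹ ∈ P.ring) :
    P.ord f = 0 := by
  by_cases h : f = 0
  · simp [h, Place.ord]
  · rw [Place.mem_ring_iff h] at hf
    rw [Place.mem_ring_iff (inv_ne_zero h), Place.ord_inv] at hf'
    omega

theorem Place.ring_injective {P Q : Place K F} (h : P.ring = Q.ring) : P = Q := by
  cases P; cases Q; cases h; rfl

/-- Discrete valuation rings are maximal proper subrings. -/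
theorem Place.eq_of_ring_le {P Q : Place K F} (h : ∀ f ∈ Q.ring, f ∈ P.ring) : P = Q := by
  apply Place.ring_injective
  refine le_antisymm (fun f hf => ?_) h
  by_contra hfQ
  have hf0 : f ≠ 0 := by rintro rfl; exact hfQ (zero_mem _)
  rw [Place.mem_ring_iff hf0, not_le] at hfQ
  -- An f with a pole at Q absorbs any pole: g / f^n is regular at Q for large n, hence at P, and f
  -- is regular at P.
  have hall : ∀ g : F, g ∈ P.ring := by
    intro g
    by_cases hg : g = 0
    · rw [hg]; exact zero_mem _
    obtain ⟨n, hn⟩ : ∃ n : ℕ, 0 ≤ Q.ord g - n * Q.ord f :=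
      ⟨(Q.ord g).natAbs, by
        have h1 : -(((Q.ord g).natAbs : ℕ) : ℤ) ≤ Q.ord g := by omega
        have h2 : (0 : ℤ) ≤ ((Q.ord g).natAbs : ℕ) := by omega
        nlinarith⟩
    have h1 : g * (f ^ n)⁻¹ ∈ Q.ring := by
      rw [Place.mem_ring_iff (mul_ne_zero hg (inv_ne_zero (pow_ne_zero _ hf0))),
        Place.ord_mul hg (inv_ne_zero (pow_ne_zero _ hf0)), Place.ord_inv, Place.ord_pow]
      linarith
    have h2 := mul_mem (h _ h1) (pow_mem hf n)
    rwa [inv_mul_cancel_right₀ (pow_ne_zero n hf0)] at h2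
  obtain ⟨t, ht⟩ := P.exists_isUniformizer
  have := hall t⁻¹
  rw [Place.mem_ring_iff (inv_ne_zero ht.ne_zero), Place.ord_inv,
    Place.isUniformizer_iff.1 ht] at this
  omega

theorem IsFunctionField.D_ne_zero_of_isUniformizer (p : ℕ) [CharP F p] [Fact p.Prime]
    [PerfectField K] (hF : IsFunctionField K F)
    {t : F} (ht : P.IsUniformizer t) : D K F t ≠ 0 := by
  intro h
  obtain ⟨g, rfl⟩ := hF.eq_pow_of_D_eq_zero p h
  have h1 := Place.isUniformizer_iff.1 ht
  rw [Place.ord_pow] at h1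
  have h2 : (p : ℤ) ∣ 1 := ⟨_, h1.symm⟩
  have := (Fact.out : p.Prime).one_lt
  have := Int.le_of_dvd one_pos h2
  omega

/-- The nonzero terms have orders p · ord(g_i) + i, distinct modulo p, so poles cannot cancel and
each term is regular. As i < p, this forces ord(g_i) ≥ 0. -/
theorem Place.mem_ring_of_sum_pow_mul_pow_mem {p : ℕ} [Fact p.Prime]
    {t : F} (ht : P.IsUniformizer t) (g : ℕ → F)
    (h : ∑ i ∈ Finset.range p, g i ^ p * t ^ i ∈ P.ring) : ∀ i < p, g i ∈ P.ring := by
  have hp : p.Prime := Fact.out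
  have ht0 := ht.ne_zero
  have hord : ∀ i, g i ≠ 0 → P.ord (g i ^ p * t ^ i) = p * P.ord (g i) + i := by
    intro i hi
    rw [Place.ord_mul (pow_ne_zero _ hi) (pow_ne_zero _ ht0), Place.ord_pow, Place.ord_pow,
      Place.isUniformizer_iff.1 ht, mul_one]
  have hterm : ∀ i ∈ Finset.range p, P.val (g i ^ p * t ^ i) ≤ 1 := by
    obtain ⟨i, hi, hmax⟩ := Finset.exists_max_image (Finset.range p)
      (fun i => P.val (g i ^ p * t ^ i)) ⟨0, Finset.mem_range.2 hp.pos⟩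
    by_contra hcon
    push Not at hcon
    obtain ⟨k, hk, hk1⟩ := hcon
    have hi1 : 1 < P.val (g i ^ p * t ^ i) := hk1.trans_le (hmax k hk)
    have hne : P.val (g i ^ p * t ^ i) ≠ 0 := (zero_lt_one.trans hi1).ne'
    have hgi : g i ≠ 0 := by
      intro h0
      rw [h0, zero_pow hp.ne_zero, zero_mul, map_zero] at hne
      exact hne rfl
    have hlt : ∀ j ∈ (Finset.range p).erase i, P.val (g j ^ p * t ^ j) <
        P.val (g i ^ p * t ^ i) := by
      intro j hj
      obtain ⟨hji, hj⟩ := Finset.mem_erase.1 hj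
      refine lt_of_le_of_ne (hmax j hj) fun heq => hji ?_
      have hgj : g j ≠ 0 := by
        intro h0
        rw [h0, zero_pow hp.ne_zero, zero_mul, map_zero] at heq
        exact hne heq.symm
      have hordeq : P.ord (g j ^ p * t ^ j) = P.ord (g i ^ p * t ^ i) := by
        rw [Place.ord, heq, Place.ord]
      rw [hord i hgi, hord j hgj] at hordeq
      have hmod := congrArg (· % (p : ℤ)) hordeq
      simp only [Int.mul_add_emod_self_left] at hmod
      rw [Int.emod_eq_of_lt (by omega) (by have := Finset.mem_range.1 hj; omega),
        Int.emod_eq_of_lt (by omega) (by have := Finset.mem_range.1 hi; omega)] at hmod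
      exact_mod_cast hmod
    rw [← Finset.add_sum_erase _ _ hi, ← P.val_le_one_iff,
      Valuation.map_add_eq_of_lt_left _ (P.val.map_sum_lt hne hlt)] at h
    exact absurd hi1 (not_lt.2 h)
  intro i hi
  by_cases hgi : g i = 0
  · rw [hgi]; exact zero_mem _
  have h1 := hterm i (Finset.mem_range.2 hi)
  rw [P.val_le_one_iff, Place.mem_ring_iff (mul_ne_zero (pow_ne_zero _ hgi) (pow_ne_zero _ ht0)),
    hord i hgi] at h1
  rw [Place.mem_ring_iff hgi]
  by_contra hneg
  nlinarith

/-- The differential of a regular function is regular. -/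
theorem IsFunctionField.exists_D_eq_smul (p : ℕ) [CharP F p] [Fact p.Prime]
    [PerfectField K] (hF : IsFunctionField K F)
    {t : F} (ht : P.IsUniformizer t) {h : F} (hh : h ∈ P.ring) :
    ∃ g ∈ P.ring, D K F h = g • D K F t := by
  obtain ⟨g, rfl⟩ := hF.exists_sum_pow_mul_pow p (hF.D_ne_zero_of_isUniformizer p ht) h
  have hg := Place.mem_ring_of_sum_pow_mul_pow_mem ht g hh
  refine ⟨_, ?_, D_sum_pow_mul_pow p g t _⟩
  refine sum_mem fun i hi => ?_
  exact mul_mem (mul_mem (natCast_mem _ i) (pow_mem (hg i (Finset.mem_range.1 hi)) p))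
    (pow_mem ht.mem_ring _)

/-- Local shape of a logarithmic form. -/
theorem IsFunctionField.exists_dlog_eq (p : ℕ) [CharP F p] [Fact p.Prime]
    [PerfectField K] (hF : IsFunctionField K F)
    {t : F} (ht : P.IsUniformizer t) {f : F} (hf : f ≠ 0) :
    ∃ g ∈ P.ring, dlog K f = ((P.ord f : F) * t⁻¹ + g) • D K F t := by
  -- Write f = u t^m with u a unit at P: then dlog f = m dt/t + du/u, where du/u is regular.
  have ht0 := ht.ne_zero
  set u := f * t ^ (- P.ord f) with hu
  have hu0 : u ≠ 0 := mul_ne_zero hf (zpow_ne_zero _ ht0)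
  have hordu : P.ord u = 0 := by
    rw [hu, Place.ord_mul hf (zpow_ne_zero _ ht0), Place.ord_zpow, Place.isUniformizer_iff.1 ht]
    ring
  have hur : u ∈ P.ring := by rw [Place.mem_ring_iff hu0, hordu]
  have hur' : u⁻¹ ∈ P.ring := by
    rw [Place.mem_ring_iff (inv_ne_zero hu0), Place.ord_inv, hordu, neg_zero]
  obtain ⟨g, hg, hDu⟩ := hF.exists_D_eq_smul p ht hur
  have hfu : f = u * t ^ (P.ord f) := by
    rw [hu, mul_assoc, ← zpow_add₀ ht0]; simp
  refine ⟨u⁻¹ * g, mul_mem hur' hg, ?_⟩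
  conv_lhs => rw [hfu]
  rw [dlog_mul hu0 (zpow_ne_zero _ ht0), dlog_zpow ht0, dlog, hDu, dlog, add_comm, add_smul,
    mul_smul, mul_smul, ← Int.cast_smul_eq_zsmul F]

end Places

/-! ### The integral closure of K[x] in F. -/

section IntegralClosure

open scoped Polynomial

variable {K F : Type*} [Field K] [Field F] [Algebra K F]

theorem exists_mul_aeval_eq_of_mem_adjoin {x z : F} (hz : z ∈ IntermediateField.adjoin K {x}) :
    ∃ r s : K[X], Polynomial.aeval x s ≠ 0 ∧
      z * Polynomial.aeval x s = Polynomial.aeval x r := by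
  obtain ⟨r, s, rfl⟩ := (IntermediateField.mem_adjoin_simple_iff K z).1 hz
  by_cases hs : Polynomial.aeval x s = 0
  · exact ⟨0, 1, by simp, by simp [hs]⟩
  · exact ⟨r, s, hs, div_mul_cancel₀ _ hs⟩

/-- The ring of functions regular where `x` is: its arithmetic properties. -/
theorem IsFunctionField.exists_dedekind (p : ℕ) [CharP F p] [Fact p.Prime] [Finite K]
    (hF : IsFunctionField K F) {x : F} (hx : D K F x ≠ 0) :
    ∃ A : Subring F, IsDedekindDomain A ∧ IsFractionRing A F ∧ Finite (ClassGroup A) ∧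
      (∀ c : K, algebraMap K F c ∈ A) ∧
      (∃ M : Ideal A, M.IsMaximal ∧ x ∈ Subtype.val '' (M : Set A)) ∧
      (∀ P : Place K F, x ∈ P.ring → ∀ a ∈ A, a ∈ P.ring) ∧
      (∃ Y : Finset F, ∀ a ∈ A, a ∈ Submodule.span (Algebra.adjoin K {x}) (Y : Set F)) ∧
      (∃ b : Module.Basis (Fin (Module.finrank (IntermediateField.adjoin K {x}) F))
        (IntermediateField.adjoin K {x}) F, ∀ i, b i ∈ A) := by
  have htr := hF.transcendental_of_D_ne_zero hx
  have hfin := hF.finite_adjoin p hx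
  have hsep := hF.isSeparable_adjoin p hx
  let E := IntermediateField.adjoin K {x}
  let x' : E := ⟨x, IntermediateField.mem_adjoin_simple_self K x⟩
  let : Algebra K[X] F := (Polynomial.aeval (R := K) x).toAlgebra
  let : Algebra K[X] E := (Polynomial.aeval (R := K) x').toAlgebra
  have hcomp : ∀ r : K[X], ((Polynomial.aeval x' r : E) : F) = Polynomial.aeval x r := fun r =>
    (Polynomial.aeval_algebraMap_apply F x' r).symm
  have hst : IsScalarTower K[X] E F := IsScalarTower.of_algebraMap_eq fun r => (hcomp r).symm
  have hinj : Function.Injective (Polynomial.aeval (R := K) x) :=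
    transcendental_iff_injective.1 htr
  have hinj' : Function.Injective (algebraMap K[X] E) := by
    intro r s hrs
    apply hinj
    rw [← hcomp, ← hcomp]
    exact congrArg _ hrs
  have hfrac : IsFractionRing K[X] E := by
    have : FaithfulSMul K[X] E := (faithfulSMul_iff_algebraMap_injective _ _).2 hinj'
    refine IsFractionRing.of_field K[X] E fun z => ?_
    obtain ⟨r, s, hs, hrs⟩ := exists_mul_aeval_eq_of_mem_adjoin z.2
    refine ⟨r, s, ?_⟩
    apply Subtype.ext
    change (z : F) = ((Polynomial.aeval x' r / Polynomial.aeval x' s : E) : F)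
    rw [IntermediateField.coe_div, hcomp, hcomp, eq_div_iff hs, hrs]
  let S := integralClosure K[X] F
  have hded : IsDedekindDomain S := IsIntegralClosure.isDedekindDomain K[X] E F S
  have hfr : IsFractionRing S F := IsIntegralClosure.isFractionRing_of_finite_extension K[X] E F S
  -- Finiteness of K makes the degree absolute value on K[X] admissible; this is the source of all
  -- units below.
  have hcl : Finite (ClassGroup S) := by
    let := Fintype.ofFinite K
    classical
    have := ClassGroup.fintypeOfAdmissibleOfFinite (S := S) E F
      (Polynomial.cardPowDegreeIsAdmissible :
        AbsoluteValue.IsAdmissible (Polynomial.cardPowDegree : AbsoluteValue K[X] ℤ))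
    exact Finite.of_fintype _
  have hmod : Module.Finite K[X] S := IsIntegralClosure.finite K[X] E F S
  refine ⟨S.toSubring, hded, hfr, hcl, fun c => ?_, ?_, ?_, ?_, ?_⟩
  · have : IsIntegral K[X] (algebraMap K[X] F (Polynomial.C c)) := isIntegral_algebraMap
    have hc : algebraMap K[X] F (Polynomial.C c) = algebraMap K F c := Polynomial.aeval_C x c
    rwa [hc] at this
  -- A maximal ideal over (X) contains x; localizing at it will give a place where x vanishes.
  · have hmax : (Ideal.span {(Polynomial.X : K[X])}).IsMaximal :=
      PrincipalIdealRing.isMaximal_of_irreducible Polynomial.irreducible_X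
    have hinjS : Function.Injective (algebraMap K[X] S) := by
      intro r s hrs
      exact hinj (congrArg Subtype.val hrs)
    obtain ⟨M, hM, hMc⟩ := Ideal.exists_ideal_over_maximal_of_isIntegral (S := S)
      (Ideal.span {(Polynomial.X : K[X])}) (by
        rw [(RingHom.injective_iff_ker_eq_bot _).1 hinjS]; exact bot_le)
    refine ⟨M, hM, algebraMap K[X] S Polynomial.X, ?_, ?_⟩
    · have : (Polynomial.X : K[X]) ∈ M.comap (algebraMap K[X] S) := by
        rw [hMc]; exact Ideal.mem_span_singleton_self _
      exact this
    · exact Polynomial.aeval_X x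
  · intro P hxP a ha
    have ha : IsIntegral K[X] a := ha
    let R : Subalgebra K F :=
      { P.ring.toSubring with algebraMap_mem' := P.algebraMap_mem }
    have hmem : ∀ r : K[X], algebraMap K[X] F r ∈ P.ring := fun r => by
      have : Polynomial.aeval x r ∈ R := by
        have hle : Algebra.adjoin K {x} ≤ R :=
          Algebra.adjoin_le (Set.singleton_subset_iff.2 hxP)
        exact hle (Polynomial.aeval_mem_adjoin_singleton K x)
      exact this
    obtain ⟨f, hfm, hf0⟩ := ha
    have hintegral : IsIntegral P.ring a := by
      let φ : K[X] →+* P.ring := (algebraMap K[X] F).codRestrict P.ring hmem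
      refine ⟨f.map φ, hfm.map φ, ?_⟩
      rw [Polynomial.eval₂_map]
      exact hf0
    obtain ⟨b, hb⟩ := IsIntegrallyClosed.isIntegral_iff.1 hintegral
    rw [← hb]
    exact b.2
  · obtain ⟨Y, hY⟩ := hmod
    classical
    refine ⟨Y.image Subtype.val, fun a ha => ?_⟩
    have h1 : (⟨a, ha⟩ : S) ∈ Submodule.span K[X] (Y : Set S) := by rw [hY]; trivial
    rw [Finset.coe_image]
    have key : ∀ s : S, s ∈ Submodule.span K[X] (Y : Set S) → (s : F) ∈
        Submodule.span (Algebra.adjoin K {x}) (Subtype.val '' (Y : Set S)) := by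
      intro s hs
      induction hs using Submodule.span_induction with
      | mem s hs => exact Submodule.subset_span ⟨s, hs, rfl⟩
      | zero => exact zero_mem _
      | add s t _ _ hs ht => exact add_mem hs ht
      | smul r s _ hs =>
        have hr : Polynomial.aeval x r ∈ Algebra.adjoin K {x} := by
          rw [Algebra.adjoin_singleton_eq_range_aeval]; exact ⟨r, rfl⟩
        exact Submodule.smul_mem _ (⟨_, hr⟩ : Algebra.adjoin K {x}) hs
    exact key _ h1
  · classical
    obtain ⟨s, b, hb⟩ := FiniteDimensional.exists_is_basis_integral K[X] E F
    have hcard := Module.finrank_eq_card_basis b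
    refine ⟨b.reindex (Fintype.equivFinOfCardEq hcard.symm), fun i => ?_⟩
    rw [Module.Basis.reindex_apply]
    exact hb _

end IntegralClosure

/-! ### Places as primes of a Dedekind subring. -/

section PlacesOverSubring

variable {K F : Type*} [Field K] [Field F] [Algebra K F] (A : Subring F)

/-- The contraction to `A` of the maximal ideal at a place. -/
def Place.under (P : Place K F) (hP : ∀ a ∈ A, a ∈ P.ring) : Ideal A :=
  (IsLocalRing.maximalIdeal P.ring).comap (Subring.inclusion (T := P.ring.toSubring) hP)

variable {A} {P : Place K F} (hP : ∀ a ∈ A, a ∈ P.ring)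

instance : (P.under A hP).IsPrime := Ideal.IsPrime.comap _

theorem Place.mem_under_iff {a : A} : a ∈ P.under A hP ↔ a = 0 ∨ 0 < P.ord (a : F) := by
  have h1 : a ∈ P.under A hP ↔ ¬ IsUnit (⟨a, hP a a.2⟩ : P.ring) := by
    rw [Place.under, Ideal.mem_comap, IsLocalRing.mem_maximalIdeal]; rfl
  rw [h1]
  by_cases ha : a = 0
  · subst ha
    simp only [true_or, iff_true]
    intro h
    exact h.ne_zero rfl
  have ha' : (a : F) ≠ 0 := fun h => ha (Subtype.ext h)
  have hr := (Place.mem_ring_iff ha').1 (hP a a.2)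
  simp only [ha, false_or]
  constructor
  · intro h
    by_contra hcon
    apply h
    have hinv : (a : F)⁻¹ ∈ P.ring := by
      rw [Place.mem_ring_iff (inv_ne_zero ha'), Place.ord_inv]; omega
    exact IsUnit.of_mul_eq_one ⟨_, hinv⟩ (Subtype.ext (mul_inv_cancel₀ ha'))
  · intro h hu
    obtain ⟨b, hb⟩ := hu.exists_right_inv
    have hb' : (a : F) * b = 1 := congrArg Subtype.val hb
    have hb0 : (b : F) ≠ 0 := right_ne_zero_of_mul_eq_one hb'
    have := (Place.mem_ring_iff hb0).1 b.2
    have h2 := Place.ord_mul (P := P) ha' hb0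
    rw [hb', Place.ord_one] at h2
    omega

theorem Place.inv_mem_of_notMem_under {b : A} (hb : b ∉ P.under A hP) : (b : F)⁻¹ ∈ P.ring := by
  rw [Place.mem_under_iff, not_or] at hb
  have hb0 : (b : F) ≠ 0 := fun h => hb.1 (Subtype.ext h)
  rw [Place.mem_ring_iff (inv_ne_zero hb0), Place.ord_inv]
  omega

variable [IsFractionRing A F]

theorem Place.under_ne_bot : P.under A hP ≠ ⊥ := by
  intro h
  have hall : ∀ f : F, f ∈ P.ring := by
    intro f
    obtain ⟨a, b, hb, rfl⟩ := IsFractionRing.div_surjective A f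
    have hb0 : b ≠ 0 := nonZeroDivisors.ne_zero hb
    have hb0' : (b : F) ≠ 0 := fun h => hb0 (Subtype.ext h)
    have hb1 : b ∉ P.under A hP := by rw [h]; exact hb0
    rw [Place.mem_under_iff, not_or] at hb1
    change (a : F) / b ∈ P.ring
    rw [div_eq_mul_inv]
    refine mul_mem (hP a a.2) ?_
    rw [Place.mem_ring_iff (inv_ne_zero hb0'), Place.ord_inv]
    omega
  obtain ⟨t, ht⟩ := P.exists_isUniformizer
  have := hall t⁻¹
  rw [Place.mem_ring_iff (inv_ne_zero ht.ne_zero), Place.ord_inv,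
    Place.isUniformizer_iff.1 ht] at this
  omega

variable [IsDedekindDomain A]

/-- The point of `Spec A` under a place. -/
def Place.underSpec (hP : ∀ a ∈ A, a ∈ P.ring) : IsDedekindDomain.HeightOneSpectrum A :=
  ⟨P.under A hP, inferInstance, Place.under_ne_bot hP⟩

/-- The local ring at a place is a localization of `A`. -/
theorem Place.exists_eq_div {g : F} (hg : g ∈ P.ring) :
    ∃ a b : A, b ∉ P.under A hP ∧ g * b = a := by
  obtain ⟨n, d, h | h⟩ :=
    (P.underSpec hP).exists_primeCompl_mul_eq_or_mul_eq (K := F) g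
  · exact ⟨n, d, d.2, h⟩
  · refine ⟨d, n, fun hn => d.2 ?_, h⟩
    change (d : A) ∈ P.under A hP
    have h' : g * (n : F) = (d : A) := h
    rw [Place.mem_under_iff] at hn ⊢
    rcases hn with rfl | hn
    · left
      apply Subtype.ext
      rw [← h']; simp
    · by_cases hd : (d : A) = 0
      · exact Or.inl hd
      right
      have hd' : ((d : A) : F) ≠ 0 := fun h => hd (Subtype.ext h)
      rw [← h'] at hd' ⊢
      have hg0 := left_ne_zero_of_mul hd'
      rw [Place.ord_mul hg0 (right_ne_zero_of_mul hd')]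
      have := (Place.mem_ring_iff hg0).1 hg
      omega

/-- Functions regular at Q are fractions whose denominators avoid the common prime, so they are
regular at P too. Hence places regular on A inject into the primes of A. -/
theorem Place.eq_of_under_eq {Q : Place K F} (hQ : ∀ a ∈ A, a ∈ Q.ring)
    (h : P.under A hP = Q.under A hQ) : P = Q := by
  refine Place.eq_of_ring_le fun g hg => ?_
  obtain ⟨a, b, hb, hab⟩ := Place.exists_eq_div hQ hg
  rw [← h] at hb
  have hb0 : (b : F) ≠ 0 := fun h0 => hb (by
    rw [show b = 0 from Subtype.ext h0]; exact zero_mem _)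
  have := mul_mem (hP a a.2) (Place.inv_mem_of_notMem_under hP hb)
  rwa [← hab, mul_inv_cancel_right₀ hb0] at this

end PlacesOverSubring

/-! ### Functions with prescribed zeros; finiteness of zeros and poles. -/

section Arithmetic

variable {K F : Type*} [Field K] [Field F] [Algebra K F]

/-- A function vanishing at `Q` only, among the places where `x` is regular. -/
theorem IsFunctionField.exists_ord_pos_only_at (p : ℕ) [CharP F p] [Fact p.Prime]
    [Finite K] (hF : IsFunctionField K F) {x : F} (hx : D K F x ≠ 0)
    {Q : Place K F} (hQ : x ∈ Q.ring) :
    ∃ f : F, f ≠ 0 ∧ 0 < Q.ord f ∧ ∀ P : Place K F, x ∈ P.ring → P ≠ Q → P.ord f = 0 := by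
  obtain ⟨A, hded, hfr, hcl, -, -, hreg, -, -⟩ := hF.exists_dedekind p hx
  have hq0 := Place.under_ne_bot (hreg Q hQ)
  let q : nonZeroDivisors (Ideal A) := ⟨Q.under A (hreg Q hQ), mem_nonZeroDivisors_of_ne_zero hq0⟩
  -- A power of the prime under Q is principal, and its generator is the required function.
  have h1 : (ClassGroup.mk0 q) ^ Nat.card (ClassGroup A) = 1 := pow_card_eq_one'
  rw [← map_pow, ClassGroup.mk0_eq_one_iff] at h1
  set h := Nat.card (ClassGroup A) with hh
  have hpos : h ≠ 0 := Nat.card_pos.ne'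
  obtain ⟨⟨f, hf⟩⟩ := h1
  have hf' : (Q.under A (hreg Q hQ)) ^ h = Ideal.span {f} := hf
  have hf0 : f ≠ 0 := by
    rintro rfl
    rw [Ideal.span_singleton_eq_bot.2 rfl] at hf'
    exact pow_ne_zero h hq0 hf'
  have hfF : (f : F) ≠ 0 := fun h => hf0 (Subtype.ext h)
  have hfq : f ∈ Q.under A (hreg Q hQ) :=
    Ideal.pow_le_self hpos (hf' ▸ Ideal.mem_span_singleton_self f)
  refine ⟨f, hfF, ((Place.mem_under_iff _).1 hfq).resolve_left hf0, fun P hP hPQ => ?_⟩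
  have hr := (Place.mem_ring_iff hfF).1 (hreg P hP f f.2)
  by_contra hne
  apply hPQ
  have hfP : f ∈ P.under A (hreg P hP) := (Place.mem_under_iff _).2 (Or.inr (by omega))
  have hle : (Q.under A (hreg Q hQ)) ^ h ≤ P.under A (hreg P hP) := by
    rw [hf', Ideal.span_le, Set.singleton_subset_iff]; exact hfP
  have hle' := Ideal.IsPrime.le_of_pow_le hle
  have hmax : (Q.under A (hreg Q hQ)).IsMaximal :=
    Ideal.IsPrime.isMaximal inferInstance hq0
  have heq := hmax.eq_of_le (Ideal.IsPrime.ne_top inferInstance) hle'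
  exact (Place.eq_of_under_eq (hreg Q hQ) (hreg P hP) heq).symm

theorem IsFunctionField.finite_ord_pos_of_regular (p : ℕ) [CharP F p] [Fact p.Prime]
    [Finite K] (hF : IsFunctionField K F) {x : F} (hx : D K F x ≠ 0) {z : F} (hz : z ≠ 0) :
    {P : Place K F | x ∈ P.ring ∧ 0 < P.ord z}.Finite := by
  obtain ⟨A, hded, hfr, hcl, -, -, hreg, -, -⟩ := hF.exists_dedekind p hx
  obtain ⟨a, b, hb, rfl⟩ := IsFractionRing.div_surjective A z
  change (a : F) / b ≠ 0 at hz
  change {P : Place K F | x ∈ P.ring ∧ 0 < P.ord ((a : F) / b)}.Finite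
  have ha0 : (a : F) ≠ 0 := fun h => hz (by rw [h, zero_div])
  have hb0 : (b : F) ≠ 0 := fun h => hz (by rw [h, div_zero])
  have hI : Ideal.span {a} ≠ ⊥ := by
    rw [Ne, Ideal.span_singleton_eq_bot]
    exact fun h => ha0 (by rw [h]; rfl)
  have hfin := Ideal.finite_factors hI
  have hinj : Function.Injective
      (fun P : {P : Place K F // x ∈ P.ring} => P.1.underSpec (hreg P.1 P.2)) := by
    intro P Q hPQ
    exact Subtype.ext (Place.eq_of_under_eq (hreg P.1 P.2) (hreg Q.1 Q.2)
      (congrArg IsDedekindDomain.HeightOneSpectrum.asIdeal hPQ))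
  refine ((hfin.preimage hinj.injOn).image Subtype.val).subset ?_
  rintro P ⟨hP, hord⟩
  refine ⟨⟨P, hP⟩, ?_, rfl⟩
  rw [div_eq_mul_inv, Place.ord_mul ha0 (inv_ne_zero hb0), Place.ord_inv] at hord
  have := (Place.mem_ring_iff hb0).1 (hreg P hP b b.2)
  change P.under A (hreg P hP) ∣ Ideal.span {a}
  rw [Ideal.dvd_span_singleton, Place.mem_under_iff]
  right
  omega

theorem Place.mem_ring_or_inv_mem (P : Place K F) (x : F) : x ∈ P.ring ∨ x⁻¹ ∈ P.ring :=
  P.ring.mem_or_inv_mem x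

theorem D_inv_ne_zero {x : F} (hx : D K F x ≠ 0) : D K F x⁻¹ ≠ 0 := by
  have hx0 : x ≠ 0 := by rintro rfl; exact hx (map_zero _)
  rw [Derivation.leibniz_inv]
  exact smul_ne_zero (neg_ne_zero.2 (pow_ne_zero _ (inv_ne_zero hx0))) hx

theorem IsFunctionField.exists_D_ne_zero (p : ℕ) [CharP F p] [Fact p.Prime]
    [PerfectField K] (hF : IsFunctionField K F) : ∃ x : F, D K F x ≠ 0 := by
  obtain ⟨x, hx, -⟩ := hF.exists_expansion p
  exact ⟨x, hx⟩

theorem IsFunctionField.finite_ord_pos (p : ℕ) [CharP F p] [Fact p.Prime]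
    [Finite K] (hF : IsFunctionField K F) {z : F} (hz : z ≠ 0) :
    {P : Place K F | 0 < P.ord z}.Finite := by
  obtain ⟨x, hx⟩ := hF.exists_D_ne_zero p
  refine ((hF.finite_ord_pos_of_regular p hx hz).union
    (hF.finite_ord_pos_of_regular p (D_inv_ne_zero hx) hz)).subset fun P hP => ?_
  exact (P.mem_ring_or_inv_mem x).imp (fun h => ⟨h, hP⟩) (fun h => ⟨h, hP⟩)

theorem IsFunctionField.finite_notMem_ring (p : ℕ) [CharP F p] [Fact p.Prime]
    [Finite K] (hF : IsFunctionField K F) (z : F) :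
    {P : Place K F | z ∉ P.ring}.Finite := by
  by_cases hz : z = 0
  · refine Set.finite_empty.subset fun P hP => hP ?_
    rw [hz]; exact zero_mem _
  refine (hF.finite_ord_pos p (inv_ne_zero hz)).subset fun P hP => ?_
  change z ∉ P.ring at hP
  rw [Place.mem_ring_iff hz] at hP
  change 0 < P.ord z⁻¹
  rw [Place.ord_inv]
  omega

/-- The form `dx` generates the regular forms at almost all places. -/
theorem IsFunctionField.finite_not_generates (p : ℕ) [CharP F p] [Fact p.Prime]
    [Finite K] (hF : IsFunctionField K F) {x : F} (hx : D K F x ≠ 0) :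
    {P : Place K F | ¬ (x ∈ P.ring ∧
      ∀ g ∈ P.ring, ∃ k ∈ P.ring, D K F g = k • D K F x)}.Finite := by
  obtain ⟨A, hded, hfr, hcl, -, -, hreg, ⟨Y, hY⟩, -⟩ := hF.exists_dedekind p hx
  have hc := fun y : F => hF.exists_smul_D p hx (D K F y)
  choose h hh using hc
  have hfin : (⋃ y ∈ Y, ({P : Place K F | h y ∉ P.ring} ∪ {P : Place K F | y ∉ P.ring})).Finite :=
    Set.Finite.biUnion Y.finite_toSet fun y _ =>
      (hF.finite_notMem_ring p (h y)).union (hF.finite_notMem_ring p y)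
  refine ((hF.finite_notMem_ring p x).union hfin).subset fun P hP => ?_
  by_contra hcon
  rw [Set.mem_union, not_or] at hcon
  obtain ⟨hxP, hYP⟩ := hcon
  have hxP : x ∈ P.ring := not_not.1 hxP
  have hYP' : ∀ y ∈ Y, y ∈ P.ring ∧ h y ∈ P.ring := by
    intro y hy
    constructor <;> by_contra hn <;> apply hYP <;>
      simp only [Set.mem_iUnion, Set.mem_union, Set.mem_ofPred_eq]
    · exact ⟨y, hy, Or.inr hn⟩
    · exact ⟨y, hy, Or.inl hn⟩
  apply hP
  refine ⟨hxP, ?_⟩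
  -- The regular a with da in P.ring · dx form an algebra. Away from the poles of x, of the
  -- generators `Y` and of the coefficients `h y`, it contains A; the quotient rule then gives the
  -- whole local ring.
  let R : Subalgebra K F :=
    { carrier := {a | a ∈ P.ring ∧ ∃ k ∈ P.ring, D K F a = k • D K F x}
      mul_mem' := by
        rintro a b ⟨ha, k, hk, hka⟩ ⟨hb, l, hl, hlb⟩
        refine ⟨mul_mem ha hb, a * l + b * k, add_mem (mul_mem ha hl) (mul_mem hb hk), ?_⟩
        rw [Derivation.leibniz, hka, hlb, add_smul, mul_smul, mul_smul]
      add_mem' := by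
        rintro a b ⟨ha, k, hk, hka⟩ ⟨hb, l, hl, hlb⟩
        exact ⟨add_mem ha hb, k + l, add_mem hk hl, by rw [map_add, hka, hlb, add_smul]⟩
      algebraMap_mem' := fun c => ⟨P.algebraMap_mem c, 0, zero_mem _, by simp⟩ }
  have hxR : x ∈ R := ⟨hxP, 1, one_mem _, by simp⟩
  have hadj : Algebra.adjoin K {x} ≤ R := Algebra.adjoin_le (Set.singleton_subset_iff.2 hxR)
  have hAR : ∀ a ∈ A, a ∈ R := by
    intro a ha
    have := hY a ha
    clear ha
    induction this using Submodule.span_induction with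
    | mem y hy => exact ⟨(hYP' y hy).1, h y, (hYP' y hy).2, hh y⟩
    | zero => exact zero_mem _
    | add a b _ _ ha hb => exact add_mem ha hb
    | smul r a _ ha => exact mul_mem (hadj r.2) ha
  intro g hg
  obtain ⟨a, b, hb, hab⟩ := Place.exists_eq_div (hreg P hxP) hg
  have hbi := Place.inv_mem_of_notMem_under (hreg P hxP) hb
  have hb0 : (b : F) ≠ 0 := fun h0 => hb (by
    rw [show b = 0 from Subtype.ext h0]; exact zero_mem _)
  obtain ⟨ha, k, hk, hka⟩ := hAR a a.2
  obtain ⟨hb', l, hl, hlb⟩ := hAR b b.2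
  refine ⟨(b : F)⁻¹ * (k - g * l), mul_mem hbi (sub_mem hk (mul_mem hg hl)), ?_⟩
  rw [← hab, Derivation.leibniz, hlb] at hka
  rw [mul_smul, sub_smul, mul_smul, ← hka, add_sub_cancel_left, inv_smul_smul₀ hb0]

end Arithmetic

/-! ### Codimension bounds expressed by linear conditions. -/

section Codim

variable {K V : Type*} [Field K] [AddCommGroup V] [Module K V]

/-- The elements of `M` that lie in `M'` are cut out of `M` by at most `n` linear conditions. -/
def CodimLE (M' M : Submodule K V) (n : ℕ) : Prop :=
  ∃ φ : V →ₗ[K] (Fin n → K), ∀ m ∈ M, φ m = 0 → m ∈ M'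

theorem exists_injective_linearMap_fin (W : Type*) [AddCommGroup W] [Module K W]
    [Module.Finite K W] {n : ℕ} (hn : Module.finrank K W ≤ n) :
    ∃ ψ : W →ₗ[K] (Fin n → K), Function.Injective ψ := by
  let e := (Module.finBasis K W).equivFun
  refine ⟨(Function.ExtendByZero.linearMap K (Fin.castLE hn)) ∘ₗ e.toLinearMap, ?_⟩
  intro a b hab
  apply e.injective
  funext i
  have : Function.extend (Fin.castLE hn) (e a) 0 (Fin.castLE hn i) =
      Function.extend (Fin.castLE hn) (e b) 0 (Fin.castLE hn i) := congrFun hab (Fin.castLE hn i)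
  rwa [(Fin.castLE_injective hn).extend_apply, (Fin.castLE_injective hn).extend_apply] at this

theorem CodimLE.of_linearMap {M' M : Submodule K V} {W : Type*} [AddCommGroup W] [Module K W]
    [Module.Finite K W] {n : ℕ} (hn : Module.finrank K W ≤ n) (φ : V →ₗ[K] W)
    (h : ∀ m ∈ M, φ m = 0 → m ∈ M') : CodimLE M' M n := by
  obtain ⟨ψ, hψ⟩ := exists_injective_linearMap_fin W hn
  exact ⟨ψ ∘ₗ φ, fun m hm h0 => h m hm (hψ (by simpa using h0))⟩

theorem CodimLE.trans {M M' M'' : Submodule K V} {a b : ℕ} (h : CodimLE M' M a)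
    (h' : CodimLE M'' M' b) : CodimLE M'' M (a + b) := by
  obtain ⟨φ, hφ⟩ := h
  obtain ⟨ψ, hψ⟩ := h'
  refine CodimLE.of_linearMap (W := (Fin a → K) × (Fin b → K)) (by simp) (φ.prod ψ)
    fun m hm h0 => ?_
  have h1 : φ m = 0 := congrArg Prod.fst h0
  have h2 : ψ m = 0 := congrArg Prod.snd h0
  exact hψ m (hφ m hm h1) h2

/-- The hypothesis says that the image of M in V/M' has dimension at most n. A retraction onto this
image supplies the conditions. -/
theorem CodimLE.of_forall_dependent {M' M : Submodule K V} {n : ℕ}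
    (h : ∀ z : Fin (n + 1) → V, (∀ i, z i ∈ M) → ∃ c : Fin (n + 1) → K, c ≠ 0 ∧
      ∑ i, c i • z i ∈ M') : CodimLE M' M n := by
  let q : Submodule K (V ⧸ M') := M.map M'.mkQ
  have hrank : Module.rank K q ≤ n := by
    refine rank_le fun s hs => ?_
    by_contra hcard
    push Not at hcard
    obtain ⟨f⟩ : Nonempty (Fin (n + 1) ↪ s) :=
      Function.Embedding.nonempty_of_card_le (by simpa using hcard)
    have hli := hs.comp f f.injective
    have hz : ∀ i, ∃ z ∈ M, M'.mkQ z = ((f i : q) : V ⧸ M') := fun i => (f i : q).2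
    choose z hz hzq using hz
    obtain ⟨c, hc0, hc⟩ := h z hz
    apply hc0
    rw [Fintype.linearIndependent_iff] at hli
    funext i
    refine hli c ?_ i
    apply Subtype.ext
    rw [AddSubmonoidClass.coe_finsetSum]
    have : ∑ i, c i • M'.mkQ (z i) = 0 := by
      rw [← (Submodule.Quotient.mk_eq_zero M').2 hc, ← Submodule.mkQ_apply, map_sum]
      simp
    simpa [hzq] using this
  have hfin : Module.Finite K q := by
    rw [← Module.rank_lt_aleph0_iff]
    exact hrank.trans_lt (Cardinal.natCast_lt_aleph0)
  obtain ⟨π, hπ⟩ := q.subtype.exists_leftInverse_of_injective (Submodule.ker_subtype q)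
  refine CodimLE.of_linearMap (W := q) (Module.finrank_le_of_rank_le hrank) (π ∘ₗ M'.mkQ)
    fun m hm h0 => ?_
  have h1 : π (M'.mkQ m) = ⟨M'.mkQ m, m, hm, rfl⟩ :=
    LinearMap.congr_fun hπ ⟨M'.mkQ m, m, hm, rfl⟩
  rw [LinearMap.comp_apply, h1] at h0
  exact (Submodule.Quotient.mk_eq_zero M').1 (congrArg Subtype.val h0)

theorem CodimLE.finite_bot {M : Submodule K V} {n : ℕ} (h : CodimLE ⊥ M n) :
    Module.Finite K M := by
  obtain ⟨φ, hφ⟩ := h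
  refine Module.Finite.of_injective (φ ∘ₗ M.subtype) ?_
  rw [← LinearMap.ker_eq_bot, LinearMap.ker_eq_bot']
  intro m hm
  exact Subtype.ext (hφ m m.2 hm)

theorem CodimLE.refl (M : Submodule K V) : CodimLE M M 0 :=
  ⟨0, fun _ hm _ => hm⟩

/-- A vector of `M` outside `M'` saves one condition for `M'`. -/
theorem CodimLE.of_notMem {M'' M' M : Submodule K V} {n : ℕ} (h : CodimLE M'' M (n + 1))
    (hle : M' ≤ M) (hle' : M'' ≤ M') {v : V} (hv : v ∈ M) (hv' : v ∉ M') :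
    CodimLE M'' M' n := by
  obtain ⟨φ, hφ⟩ := h
  -- If φ(M') were everything, v would agree under φ with some w in M', so v - w would lie in M'' ⊆
  -- M' and v in M'. So φ maps M' into a space of dimension at most n.
  have hlt : M'.map φ < ⊤ := by
    refine lt_top_iff_ne_top.2 fun htop => ?_
    have : φ v ∈ M'.map φ := by rw [htop]; trivial
    obtain ⟨w, hw, hwv⟩ := this
    apply hv'
    have h1 := hle' (hφ (v - w) (sub_mem hv (hle hw)) (by rw [map_sub, hwv, sub_self]))
    simpa using add_mem h1 hw
  have hfr := Submodule.finrank_lt hlt.ne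
  rw [Module.finrank_fin_fun] at hfr
  obtain ⟨π, hπ⟩ :=
    (M'.map φ).subtype.exists_leftInverse_of_injective (Submodule.ker_subtype _)
  refine CodimLE.of_linearMap (W := M'.map φ) (by omega) (π ∘ₗ φ) fun m hm h0 => ?_
  have h1 : π (φ m) = ⟨φ m, m, hm, rfl⟩ := LinearMap.congr_fun hπ ⟨φ m, m, hm, rfl⟩
  rw [LinearMap.comp_apply, h1] at h0
  exact hφ m (hle hm) (congrArg Subtype.val h0)

end Codim

/-! ### Dependence modulo multiplication by u. -/

section Dependence

open scoped Polynomial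

variable {K F : Type*} [Field K] [Field F] [Algebra K F]

/-- Cancel common factors u from the relation until some constant coefficient is nonzero. The
constant coefficients then give the combination, and all other terms are multiples of u. -/
theorem exists_dependent_mod_of_polynomial {u : F} (hu : u ≠ 0) {ι : Type*} [Fintype ι]
    (z : ι → F) (M : Submodule K F) (hM : ∀ m ∈ M, u * m ∈ M) (hz : ∀ i, z i ∈ M) (d : ℕ)
    (r : ι → K[X]) (hr : ∀ i, (r i).natDegree ≤ d) (hr0 : r ≠ 0)
    (hsum : ∑ i, Polynomial.aeval u (r i) * z i = 0) :
    ∃ c : ι → K, c ≠ 0 ∧ ∃ m ∈ M, ∑ i, c i • z i = u * m := by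
  have haev : ∀ (s : K[X]) (m : F), m ∈ M → Polynomial.aeval u s * m ∈ M := by
    intro s m hm
    induction s using Polynomial.induction_on' with
    | add s t hs ht => rw [map_add, add_mul]; exact add_mem hs ht
    | monomial n a =>
      rw [Polynomial.aeval_monomial, mul_assoc, ← Algebra.smul_def]
      refine Submodule.smul_mem _ _ ?_
      induction n with
      | zero => simpa using hm
      | succ n ih => rw [pow_succ', mul_assoc]; exact hM _ ih
  have hdec : ∀ s : K[X], Polynomial.aeval u s =
      u * Polynomial.aeval u s.divX + algebraMap K F (s.coeff 0) := by
    intro s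
    conv_lhs => rw [← Polynomial.divX_mul_X_add s]
    rw [map_add, map_mul, Polynomial.aeval_X, Polynomial.aeval_C, mul_comm]
  induction d generalizing r with
  | zero =>
    refine ⟨fun i => (r i).coeff 0, fun h => hr0 ?_, 0, zero_mem _, ?_⟩
    · funext i
      rw [Polynomial.eq_C_of_natDegree_le_zero (hr i), congrFun h i]
      simp
    · rw [mul_zero, ← hsum]
      refine Finset.sum_congr rfl fun i _ => ?_
      conv_rhs => rw [Polynomial.eq_C_of_natDegree_le_zero (hr i)]
      rw [Polynomial.aeval_C, Algebra.smul_def]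
  | succ d ih =>
    by_cases hc : (fun i => (r i).coeff 0) = 0
    · refine ih (fun i => (r i).divX) (fun i => ?_) (fun h => hr0 ?_) ?_
      · rw [Polynomial.natDegree_divX_eq_natDegree_tsub_one]
        have := hr i
        omega
      · funext i
        rw [← Polynomial.divX_mul_X_add (r i), congrFun hc i, congrFun h i]
        simp
      · have h1 : u * ∑ i, Polynomial.aeval u (r i).divX * z i = 0 := by
          rw [← hsum, Finset.mul_sum]
          refine Finset.sum_congr rfl fun i _ => ?_
          have h0 : (r i).coeff 0 = 0 := congrFun hc i
          rw [hdec (r i), h0, map_zero, add_zero, mul_assoc]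
        exact (mul_eq_zero.1 h1).resolve_left hu
    · refine ⟨fun i => (r i).coeff 0, hc, - ∑ i, Polynomial.aeval u (r i).divX * z i,
        neg_mem (sum_mem fun i _ => haev _ _ (hz i)), ?_⟩
      rw [mul_neg, eq_neg_iff_add_eq_zero, ← hsum, Finset.mul_sum, ← Finset.sum_add_distrib]
      refine Finset.sum_congr rfl fun i _ => ?_
      rw [hdec (r i), Algebra.smul_def]
      ring

/-- If `[F : K(u)] = N` then `M / uM` has dimension at most `N`. -/
theorem exists_dependent_mod {u : F} (hu : u ≠ 0)
    [Module.Finite (IntermediateField.adjoin K {u}) F]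
    {ι : Type*} [Fintype ι] (hι : Module.finrank (IntermediateField.adjoin K {u}) F < Fintype.card ι)
    (M : Submodule K F) (hM : ∀ m ∈ M, u * m ∈ M) (z : ι → F) (hz : ∀ i, z i ∈ M) :
    ∃ c : ι → K, c ≠ 0 ∧ ∃ m ∈ M, ∑ i, c i • z i = u * m := by
  classical
  have hdep : ¬ LinearIndependent (IntermediateField.adjoin K {u}) z := fun h =>
    absurd h.fintype_card_le_finrank (not_le.2 hι)
  rw [Fintype.not_linearIndependent_iff] at hdep
  obtain ⟨g, hg, i₀, hi₀⟩ := hdep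
  have hrs := fun i => exists_mul_aeval_eq_of_mem_adjoin (g i).2
  choose r s hs hrs using hrs
  let r' : ι → K[X] := fun i => r i * ∏ j ∈ Finset.univ.erase i, s j
  have hr' : ∀ i, Polynomial.aeval u (r' i) =
      (g i : F) * Polynomial.aeval u (∏ j, s j) := by
    intro i
    rw [← Finset.mul_prod_erase _ _ (Finset.mem_univ i), map_mul, map_mul, ← mul_assoc, hrs]
  have hprod : Polynomial.aeval u (∏ j, s j) ≠ 0 := by
    rw [map_prod]; exact Finset.prod_ne_zero_iff.2 fun j _ => hs j
  refine exists_dependent_mod_of_polynomial hu z M hM hz (Finset.univ.sup fun i => (r' i).natDegree)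
    r' (fun i => Finset.le_sup (f := fun i => (r' i).natDegree) (Finset.mem_univ i))
    (fun h => ?_) ?_
  · have h1 := hr' i₀
    rw [congrFun h i₀, Pi.zero_apply, map_zero] at h1
    rcases mul_eq_zero.1 h1.symm with h2 | h2
    · exact hi₀ (Subtype.ext h2)
    · exact hprod h2
  · have : ∑ i, Polynomial.aeval u (r' i) * z i =
        Polynomial.aeval u (∏ j, s j) * ∑ i, g i • z i := by
      rw [Finset.mul_sum]
      refine Finset.sum_congr rfl fun i _ => ?_
      rw [hr', IntermediateField.smul_def, smul_eq_mul]
      ring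
    rw [this, hg, mul_zero]

end Dependence

theorem isDiscreteValuationRing_valuationSubringAtPrime {R L : Type*} [CommRing R]
    [IsDedekindDomain R] [Field L] [Algebra R L] [IsFractionRing R L]
    (v : IsDedekindDomain.HeightOneSpectrum R) :
    IsDiscreteValuationRing (v.valuationSubringAtPrime L) := by
  have hloc : IsLocalization.AtPrime (v.valuationSubringAtPrime L) v.asIdeal :=
    inferInstanceAs (IsLocalization v.asIdeal.primeCompl (v.valuationSubringAtPrime L))
  exact IsLocalization.AtPrime.isDiscreteValuationRing_of_dedekind_domain R v.ne_bot _

/-! ### Existence of zeros and finiteness of residue fields. -/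

section Places

variable {K F : Type*} [Field K] [Field F] [Algebra K F]

/-- Every separating element has a zero. -/
theorem IsFunctionField.exists_ord_pos (p : ℕ) [CharP F p] [Fact p.Prime] [Finite K]
    (hF : IsFunctionField K F) {x : F} (hx : D K F x ≠ 0) : ∃ P : Place K F, 0 < P.ord x := by
  obtain ⟨A, hded, hfr, -, hKA, ⟨M, hM, x, hxM, rfl⟩, -⟩ := hF.exists_dedekind p hx
  have hx0 : x ≠ 0 := by
    rintro rfl
    exact hx (map_zero _)
  have hM0 : M ≠ ⊥ := by
    rintro rfl
    exact hx0 hxM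
  let v : IsDedekindDomain.HeightOneSpectrum A := ⟨M, hM.isPrime, hM0⟩
  have hdvr := isDiscreteValuationRing_valuationSubringAtPrime (L := F) v
  have hAv : ∀ a : A, (a : F) ∈ v.valuationSubringAtPrime F := by
    intro a
    rw [IsDedekindDomain.HeightOneSpectrum.valuationSubringAtPrime_eq_valuationSubring]
    exact v.valuation_le_one (K := F) a
  let P : Place K F := ⟨v.valuationSubringAtPrime F, fun c => hAv ⟨_, hKA c⟩, hdvr⟩
  refine ⟨P, ?_⟩
  have hxF : (x : F) ≠ 0 := fun h => hx0 (Subtype.ext h)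
  by_contra hcon
  have hinv : (x : F)⁻¹ ∈ v.valuationSubringAtPrime F := by
    change (x : F)⁻¹ ∈ P.ring
    rw [Place.mem_ring_iff (inv_ne_zero hxF), Place.ord_inv]
    omega
  rw [IsDedekindDomain.HeightOneSpectrum.valuationSubringAtPrime_eq_valuationSubring,
    Valuation.mem_valuationSubring_iff, map_inv₀] at hinv
  have hlt : v.valuation F (x : F) < 1 := (v.valuation_lt_one_iff_mem (K := F) x).2 hxM
  have hne : v.valuation F (x : F) ≠ 0 := (Valuation.ne_zero_iff _).2 hxF
  exact absurd hinv (not_le.2 ((one_lt_inv₀ (zero_lt_iff.2 hne)).2 hlt))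

/-- A function without poles has no zeros. -/
theorem IsFunctionField.eq_zero_of_forall_mem_ring (p : ℕ) [CharP F p] [Fact p.Prime] [Finite K]
    (hF : IsFunctionField K F) {f : F} (hreg : ∀ P : Place K F, f ∈ P.ring)
    {Q : Place K F} (hQ : 0 < Q.ord f) : False := by
  have hp : p.Prime := Fact.out
  -- Descent on the order at Q. If df = 0, pass to a p-th root, of smaller order; otherwise f⁻¹ is
  -- separating, and a zero of it is a pole of f.
  have key : ∀ n : ℕ, ∀ f : F, (∀ P : Place K F, f ∈ P.ring) → 0 < Q.ord f →
      Q.ord f ≤ n → False := by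
    intro n
    induction n with
    | zero => intro f _ h1 h2; push_cast at h2; omega
    | succ n ih =>
      intro f hreg hpos hle
      by_cases hD : D K F f = 0
      · obtain ⟨g, rfl⟩ := hF.eq_pow_of_D_eq_zero p hD
        have hg0 : g ≠ 0 := by
          rintro rfl
          rw [zero_pow hp.ne_zero] at hpos
          simp [Place.ord] at hpos
        have h2 : (2 : ℤ) ≤ p := by exact_mod_cast hp.two_le
        refine ih g (fun P => ?_) ?_ ?_
        · have := hreg P
          rw [Place.mem_ring_iff (pow_ne_zero _ hg0), Place.ord_pow] at this
          rw [Place.mem_ring_iff hg0]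
          by_contra hneg
          nlinarith
        · rw [Place.ord_pow] at hpos
          by_contra hneg
          nlinarith
        · rw [Place.ord_pow] at hpos hle
          have : 0 < Q.ord g := by
            by_contra hneg
            nlinarith
          push_cast at hle
          nlinarith
      · obtain ⟨P, hP⟩ := hF.exists_ord_pos p (D_inv_ne_zero hD)
        have hf0 : f ≠ 0 := by rintro rfl; exact hD (map_zero _)
        have := (Place.mem_ring_iff hf0).1 (hreg P)
        rw [Place.ord_inv] at hP
        omega
  exact key (Q.ord f).toNat f hreg hQ (by omega)

theorem Place.residue_eq_zero_iff {P : Place K F} (z : P.ring) :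
    IsLocalRing.residue P.ring z = 0 ↔ z = 0 ∨ 0 < P.ord (z : F) := by
  rw [IsLocalRing.residue_eq_zero_iff]
  exact Place.mem_under_iff (A := P.ring.toSubring) (P := P) (fun _ h => h) (a := z)

theorem Place.residue_algebraMap_mul {P : Place K F} (c : K) (z : P.ring) :
    IsLocalRing.residue P.ring (algebraMap K P.ring c * z) = c • IsLocalRing.residue P.ring z := by
  rw [map_mul, Algebra.smul_def]
  rfl

/-- For a uniformizer t the residue field is P.ring / t P.ring, of dimension at most [F : K(t)] by
`exists_dependent_mod`. -/
theorem IsFunctionField.finite_residueField (p : ℕ) [CharP F p] [Fact p.Prime] [Finite K]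
    (hF : IsFunctionField K F) (P : Place K F) :
    Module.Finite K (IsLocalRing.ResidueField P.ring) := by
  obtain ⟨t, ht⟩ := P.exists_isUniformizer
  have hfin := hF.finite_adjoin p (hF.D_ne_zero_of_isUniformizer p ht)
  let M : Submodule K F :=
    { P.ring.toSubring.toAddSubgroup with
      smul_mem' := fun c z hz => by
        rw [Algebra.smul_def]
        exact mul_mem (P.algebraMap_mem c) hz }
  have hrank : Module.rank K (IsLocalRing.ResidueField P.ring) ≤
      Module.finrank (IntermediateField.adjoin K {t}) F := by
    refine rank_le fun s hs => ?_
    by_contra hcard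
    push Not at hcard
    have hsur : ∀ i : s, ∃ z : P.ring, IsLocalRing.residue P.ring z = i := fun i =>
      IsLocalRing.residue_surjective _
    choose z hz using hsur
    obtain ⟨c, hc, m, hm, hsum⟩ := exists_dependent_mod (u := t) ht.ne_zero (ι := s)
      (by simpa using hcard) M (fun m hm => P.ring.mul_mem t m ht.mem_ring hm) (fun i => (z i : F))
      (fun i => (z i).2)
    apply hc
    rw [Fintype.linearIndependent_iff] at hs
    funext i
    refine hs c ?_ i
    have h1 : ∑ i, algebraMap K P.ring (c i) * z i = ⟨t, ht.mem_ring⟩ * ⟨m, hm⟩ := by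
      apply Subtype.ext
      rw [AddSubmonoidClass.coe_finsetSum]
      refine Eq.trans ?_ hsum
      exact Finset.sum_congr rfl fun i _ => (Algebra.smul_def _ _).symm
    have h2 := congrArg (IsLocalRing.residue P.ring) h1
    have h3 : IsLocalRing.residue P.ring ⟨t, ht.mem_ring⟩ = 0 := by
      rw [Place.residue_eq_zero_iff]
      right
      change 0 < P.ord t
      rw [Place.isUniformizer_iff.1 ht]
      norm_num
    rw [map_mul, h3, zero_mul, map_sum] at h2
    simpa only [Place.residue_algebraMap_mul, hz] using h2
  rw [← Module.rank_lt_aleph0_iff]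
  exact hrank.trans_lt Cardinal.natCast_lt_aleph0

end Places

/-! ### Spaces of differential forms: finiteness and codimension. -/

section Omega

variable {K F : Type*} [Field K] [Field F] [Algebra K F]

/-- It is enough to test one uniformizer: dt is a regular multiple of dt' for any other uniformizer
t'. -/
theorem IsFunctionField.ordGE_of_isUniformizer (p : ℕ) [CharP F p] [Fact p.Prime] [PerfectField K]
    (hF : IsFunctionField K F) {P : Place K F} {t : F} (ht : P.IsUniformizer t) {f : F} {m : ℤ}
    (hf : P.val f ≤ WithZero.exp (-m)) : P.OrdGE (f • D K F t) m := by
  intro t' ht'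
  obtain ⟨k, hk, hD⟩ := hF.exists_D_eq_smul p ht' ht.mem_ring
  refine ⟨f * k, by rw [hD, smul_smul], ?_⟩
  rw [map_mul]
  calc P.val f * P.val k ≤ P.val f * 1 := by
        gcongr
        exact P.val_le_one_iff.2 hk
    _ ≤ _ := by rwa [mul_one]

theorem Place.OrdGE.mono {P : Place K F} {ω : Ω[F⁄K]} {m m' : ℤ} (h : P.OrdGE ω m)
    (hle : m' ≤ m) : P.OrdGE ω m' := by
  intro t ht
  obtain ⟨f, hf, hv⟩ := h t ht
  exact ⟨f, hf, hv.trans (WithZero.exp_le_exp.2 (by omega))⟩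

theorem Omega_antitone {A B : Divisor K F} (h : A ≤ B) : Omega B ≤ Omega A :=
  fun _ hω P => (hω P).mono (h P)

/-- The condition is that the leading coefficient of ω at Q, an element of the residue field of
degree deg Q over K, vanishes. -/
theorem IsFunctionField.codimLE_Omega_add_single (p : ℕ) [CharP F p] [Fact p.Prime] [Finite K]
    (hF : IsFunctionField K F) (A : Divisor K F) (Q : Place K F) :
    CodimLE (Omega (A + Finsupp.single Q 1)) (Omega A) Q.degree := by
  classical
  obtain ⟨t, ht⟩ := Q.exists_isUniformizer
  have ht0 := ht.ne_zero
  have hfinκ := hF.finite_residueField p Q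
  refine CodimLE.of_forall_dependent fun ω hω => ?_
  have hloc := fun i => hω i Q t ht
  choose f hf hfv using hloc
  have hg : ∀ i, f i * t ^ (- A Q) ∈ Q.ring := by
    intro i
    by_cases h0 : f i = 0
    · rw [h0, zero_mul]; exact zero_mem _
    have := (Place.val_le_exp_iff h0 _).1 (hfv i)
    rw [Place.mem_ring_iff (mul_ne_zero h0 (zpow_ne_zero _ ht0)),
      Place.ord_mul h0 (zpow_ne_zero _ ht0), Place.ord_zpow, Place.isUniformizer_iff.1 ht]
    omega
  have hdep : ¬ LinearIndependent K
      (fun i => IsLocalRing.residue Q.ring ⟨f i * t ^ (- A Q), hg i⟩) := fun h => by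
    have := h.fintype_card_le_finrank
    rw [Fintype.card_fin] at this
    exact absurd this (by rw [Place.degree]; omega)
  rw [Fintype.not_linearIndependent_iff] at hdep
  obtain ⟨c, hc, i₀, hi₀⟩ := hdep
  refine ⟨c, fun h => hi₀ (congrFun h i₀), ?_⟩
  have hres : IsLocalRing.residue Q.ring
      (∑ i, algebraMap K Q.ring (c i) * ⟨f i * t ^ (- A Q), hg i⟩) = 0 := by
    rw [map_sum, ← hc]
    exact Finset.sum_congr rfl fun i _ => Place.residue_algebraMap_mul _ _
  rw [Place.residue_eq_zero_iff] at hres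
  have hcoe : ((∑ i, algebraMap K Q.ring (c i) * ⟨f i * t ^ (- A Q), hg i⟩ : Q.ring) : F) =
      (∑ i, algebraMap K F (c i) * f i) * t ^ (- A Q) := by
    rw [AddSubmonoidClass.coe_finsetSum, Finset.sum_mul]
    exact Finset.sum_congr rfl fun i _ => (mul_assoc _ _ _).symm
  have hsum : ∑ i, c i • ω i = (∑ i, algebraMap K F (c i) * f i) • D K F t := by
    rw [Finset.sum_smul]
    refine Finset.sum_congr rfl fun i _ => ?_
    rw [hf i, mul_smul, algebraMap_smul]
  have hA : ∑ i, c i • ω i ∈ Omega A := sum_mem fun i _ => Submodule.smul_mem _ _ (hω i)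
  intro P
  by_cases hPQ : P = Q
  · subst hPQ
    rw [Finsupp.add_apply, Finsupp.single_eq_same, hsum]
    refine hF.ordGE_of_isUniformizer p ht ?_
    by_cases h0 : ∑ i, algebraMap K F (c i) * f i = 0
    · rw [h0, map_zero]; exact zero_le
    rw [Place.val_le_exp_iff h0]
    rcases hres with h | h
    · have h' := congrArg (Subtype.val : P.ring → F) h
      rw [hcoe] at h'
      exact absurd h' (mul_ne_zero h0 (zpow_ne_zero _ ht0))
    · rw [hcoe, Place.ord_mul h0 (zpow_ne_zero _ ht0), Place.ord_zpow,
        Place.isUniformizer_iff.1 ht] at h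
      omega
  · rw [Finsupp.add_apply, Finsupp.single_eq_of_ne hPQ, add_zero]
    exact hA P

/-- The divisor with the given nonnegative multiplicities. -/
noncomputable def Divisor.ofNat (B : Place K F →₀ ℕ) : Divisor K F :=
  B.mapRange (fun n : ℕ => (n : ℤ)) rfl

theorem IsFunctionField.codimLE_Omega_add (p : ℕ) [CharP F p] [Fact p.Prime] [Finite K]
    (hF : IsFunctionField K F) (B : Place K F →₀ ℕ) (A : Divisor K F) :
    CodimLE (Omega (A + Divisor.ofNat B)) (Omega A) (B.sum fun P m => m * P.degree) := by
  induction B using Finsupp.induction generalizing A with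
  | zero =>
    have : Divisor.ofNat (0 : Place K F →₀ ℕ) = 0 := by ext; simp [Divisor.ofNat]
    rw [this, add_zero, Finsupp.sum_zero_index]
    exact CodimLE.refl _
  | single_add Q m B hQ hm ih =>
    clear hm
    rw [Finsupp.sum_add_index_of_disjoint (by
      refine Finset.disjoint_of_subset_left Finsupp.support_single_subset ?_
      simpa using hQ), Finsupp.sum_single_index (by simp)]
    have hstep : ∀ (m : ℕ) (A : Divisor K F),
        CodimLE (Omega (A + Finsupp.single Q (m : ℤ))) (Omega A) (m * Q.degree) := by
      intro m
      induction m with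
      | zero => intro A; simpa using CodimLE.refl _
      | succ m ihm =>
        intro A
        have h1 := (ihm A).trans (hF.codimLE_Omega_add_single p (A + Finsupp.single Q (m : ℤ)) Q)
        rw [add_assoc, ← Finsupp.single_add] at h1
        rw [Nat.succ_mul]
        exact_mod_cast h1
    have h2 := (hstep m A).trans (ih (A + Finsupp.single Q (m : ℤ)))
    convert h2 using 2
    rw [add_assoc]
    congr 1
    classical
    ext P
    simp [Divisor.ofNat, Finsupp.single_apply]

theorem IsFunctionField.exists_Omega_eq_bot (p : ℕ) [CharP F p] [Fact p.Prime] [Finite K]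
    (hF : IsFunctionField K F) : ∃ B : Divisor K F, Omega B = ⊥ := by
  classical
  obtain ⟨x, hx⟩ := hF.exists_D_ne_zero p
  obtain ⟨Q, -⟩ := hF.exists_ord_pos p hx
  have hfin := hF.finite_not_generates p hx
  have hunif := fun P : Place K F => P.exists_isUniformizer
  choose t ht using hunif
  have hh := fun P : Place K F => hF.exists_smul_D p (hF.D_ne_zero_of_isUniformizer p (ht P))
    (D K F x)
  choose h hh using hh
  have hh0 : ∀ P, h P ≠ 0 := fun P h0 => hx (by rw [hh P, h0, zero_smul])
  -- The sum dominates the divisor of dx at the finitely many places where dx need not generate. So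
  -- f dx in this space forces f to be regular everywhere, and the extra Q forces a zero, which is
  -- impossible for f ≠ 0.
  refine ⟨(∑ P ∈ hfin.toFinset, Finsupp.single P |P.ord (h P)|) + Finsupp.single Q 1, ?_⟩
  rw [eq_bot_iff]
  intro ω hω
  obtain ⟨f, rfl⟩ := hF.exists_smul_D p hx ω
  by_contra hne
  have hf0 : f ≠ 0 := by
    rintro rfl
    exact hne (by rw [zero_smul]; exact zero_mem _)
  have happly : ∀ P : Place K F, ((∑ P ∈ hfin.toFinset, Finsupp.single P |P.ord (h P)|) +
      Finsupp.single Q 1 : Divisor K F) P =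
      (if P ∈ hfin.toFinset then |P.ord (h P)| else 0) + (if Q = P then 1 else 0) := by
    intro P
    rw [Finsupp.add_apply, Finsupp.finsetSum_apply, Finsupp.single_apply]
    congr 1
    simp only [Finsupp.single_apply]
    rw [Finset.sum_ite_eq' hfin.toFinset P]
  have hord : ∀ P : Place K F, (if Q = P then (1 : ℤ) else 0) ≤ P.ord f := by
    intro P
    obtain ⟨g, hg, hgv⟩ := hω P (t P) (ht P)
    have hg0 : g ≠ 0 := by
      rintro rfl
      rw [zero_smul] at hg
      exact hne (by rw [hg]; exact zero_mem _)
    rw [Place.val_le_exp_iff hg0, happly] at hgv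
    by_cases hP : P ∈ hfin.toFinset
    · rw [if_pos hP] at hgv
      have heq : g = f * h P := by
        have h1 : (f * h P) • D K F (t P) = g • D K F (t P) := by rw [mul_smul, ← hh P, hg]
        rw [← sub_eq_zero, ← sub_smul, smul_eq_zero, sub_eq_zero] at h1
        exact (h1.resolve_right (hF.D_ne_zero_of_isUniformizer p (ht P))).symm
      rw [heq, Place.ord_mul hf0 (hh0 P)] at hgv
      have := le_abs_self (P.ord (h P))
      omega
    · rw [if_neg hP, zero_add] at hgv
      have hP' : x ∈ P.ring ∧ ∀ g ∈ P.ring, ∃ k ∈ P.ring, D K F g = k • D K F x := by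
        by_contra hcon
        exact hP (hfin.mem_toFinset.2 hcon)
      obtain ⟨k, hk, hkt⟩ := hP'.2 (t P) (ht P).mem_ring
      have hk0 : k ≠ 0 := by
        rintro rfl
        exact hF.D_ne_zero_of_isUniformizer p (ht P) (by rw [hkt, zero_smul])
      have heq : f = g * k := by
        have h1 : f • D K F x = (g * k) • D K F x := by rw [mul_smul, ← hkt, hg]
        rw [← sub_eq_zero, ← sub_smul, smul_eq_zero, sub_eq_zero] at h1
        exact h1.resolve_right hx
      rw [heq, Place.ord_mul hg0 hk0]
      have := (Place.mem_ring_iff hk0).1 hk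
      omega
  refine hF.eq_zero_of_forall_mem_ring p (f := f) (Q := Q) (fun P => ?_) ?_
  · rw [Place.mem_ring_iff hf0]
    refine le_trans ?_ (hord P)
    split_ifs <;> norm_num
  · have := hord Q
    rw [if_pos rfl] at this
    omega

/-- Raising A above a divisor with no forms costs finitely many conditions. It makes h^1 a genuine
dimension rather than the default value of `finrank`. -/
theorem IsFunctionField.finite_Omega (p : ℕ) [CharP F p] [Fact p.Prime] [Finite K]
    (hF : IsFunctionField K F) (A : Divisor K F) : Module.Finite K (Omega A) := by
  obtain ⟨B, hB⟩ := hF.exists_Omega_eq_bot p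
  let C : Place K F →₀ ℕ := (B - A).mapRange Int.toNat rfl
  have hle : B ≤ A + Divisor.ofNat C := by
    intro P
    simp only [C, Divisor.ofNat, Finsupp.add_apply, Finsupp.mapRange_apply, Finsupp.sub_apply]
    omega
  have h := hF.codimLE_Omega_add p C A
  have hbot : Omega (A + Divisor.ofNat C) = ⊥ := by
    rw [eq_bot_iff, ← hB]; exact Omega_antitone hle
  rw [hbot] at h
  exact h.finite_bot

end Omega

/-! ### Multiples aM of a space of functions. -/

section Scaling

variable {K F : Type*} [Field K] [Field F] [Algebra K F]

/-- The subspace `aM`. -/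
def scale (a : F) (M : Submodule K F) : Submodule K F := M.map (LinearMap.mulLeft K a)

theorem mem_scale {a : F} {M : Submodule K F} {z : F} : z ∈ scale a M ↔ ∃ m ∈ M, a * m = z :=
  Iff.rfl

theorem scale_scale (a b : F) (M : Submodule K F) : scale a (scale b M) = scale (a * b) M := by
  ext z
  constructor
  · rintro ⟨_, ⟨m, hm, rfl⟩, rfl⟩
    exact ⟨m, hm, mul_assoc _ _ _⟩
  · rintro ⟨m, hm, rfl⟩
    exact ⟨b * m, ⟨m, hm, rfl⟩, (mul_assoc _ _ _).symm⟩

theorem scale_one (M : Submodule K F) : scale 1 M = M := by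
  ext z
  simp [mem_scale]

theorem CodimLE.scale {M' M : Submodule K F} {n : ℕ} (h : CodimLE M' M n) {a : F} (ha : a ≠ 0) :
    CodimLE (scale a M') (scale a M) n := by
  obtain ⟨φ, hφ⟩ := h
  refine ⟨φ ∘ₗ LinearMap.mulLeft K a⁻¹, ?_⟩
  rintro _ ⟨m, hm, rfl⟩ h0
  refine ⟨m, hφ m hm ?_, rfl⟩
  simpa [ha] using h0

theorem CodimLE.scale_pow {M : Submodule K F} {n : ℕ} {a : F} (ha : a ≠ 0)
    (h : CodimLE (CartierCode.scale a M) M n) (k : ℕ) :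
    CodimLE (CartierCode.scale (a ^ k) M) M (k * n) := by
  induction k with
  | zero => simpa [scale_one] using CodimLE.refl M
  | succ k ih =>
    have h1 := ih.trans (h.scale (pow_ne_zero k ha))
    rw [scale_scale, ← pow_succ] at h1
    rwa [Nat.succ_mul]

end Scaling

/-! ### Functions with a single pole. -/

section Poles

variable {K F : Type*} [Field K] [Field F] [Algebra K F]

/-- The functions regular at all places satisfying a condition. -/
def regularOn (s : Set (Place K F)) : Submodule K F where
  carrier := {f | ∀ P ∈ s, f ∈ P.ring}
  add_mem' ha hb P hP := add_mem (ha P hP) (hb P hP)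
  zero_mem' P _ := zero_mem _
  smul_mem' c f hf P hP := by
    rw [Algebra.smul_def]
    exact mul_mem (P.algebraMap_mem c) (hf P hP)

theorem mul_mem_regularOn {s : Set (Place K F)} {f g : F} (hf : f ∈ regularOn s)
    (hg : g ∈ regularOn s) : f * g ∈ regularOn s := fun P hP => mul_mem (hf P hP) (hg P hP)

theorem adjoin_simple_inv (u : F) :
    IntermediateField.adjoin K {u⁻¹} = IntermediateField.adjoin K {u} := by
  apply le_antisymm <;> rw [IntermediateField.adjoin_simple_le_iff]
  · exact inv_mem (IntermediateField.mem_adjoin_simple_self K u)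
  · have := inv_mem (IntermediateField.mem_adjoin_simple_self K u⁻¹)
    rwa [inv_inv] at this

/-- Where the uniformizer `u` at `Q` is regular, the functions allowed to have poles of
bounded order at all zeros of `u` but `Q` form a space of small codimension. -/
theorem IsFunctionField.exists_codimLE_scale (p : ℕ) [CharP F p] [Fact p.Prime] [Finite K]
    (hF : IsFunctionField K F) {Q : Place K F} {u : F} (hu : Q.IsUniformizer u) :
    ∃ (f : F) (h g : ℕ), f ≠ 0 ∧ 0 < h ∧
      g + 1 = h * Module.finrank (IntermediateField.adjoin K {u}) F ∧
      (∀ P : Place K F, u ∈ P.ring → P ≠ Q → P.ord f = 0) ∧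
      CodimLE (scale (u ^ h * f⁻¹) (regularOn {P : Place K F | u ∈ P.ring}))
        (regularOn {P : Place K F | u ∈ P.ring}) g := by
  have hDu := hF.D_ne_zero_of_isUniformizer p hu
  have hu0 := hu.ne_zero
  have hfin := hF.finite_adjoin p hDu
  obtain ⟨f, hf0, hfQ, hfP⟩ := hF.exists_ord_pos_only_at p hDu hu.mem_ring
  set N := Module.finrank (IntermediateField.adjoin K {u}) F with hN
  have hNpos : 0 < N := Module.finrank_pos
  set S := regularOn {P : Place K F | u ∈ P.ring} with hS
  obtain ⟨h, hh⟩ : ∃ h : ℕ, Q.ord f = h := ⟨(Q.ord f).toNat, by omega⟩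
  have hhpos : 0 < h := by omega
  obtain ⟨g, hg⟩ : ∃ g, g + 1 = h * N := ⟨h * N - 1, by
    have := Nat.mul_pos hhpos hNpos
    omega⟩
  refine ⟨f, h, g, hf0, hhpos, hg, hfP, ?_⟩
  have huS : u ∈ S := fun P hP => hP
  have h1S : (1 : F) ∈ S := fun P _ => one_mem _
  have hfS : f ∈ S := by
    intro P hP
    rw [Place.mem_ring_iff hf0]
    by_cases hPQ : P = Q
    · rw [hPQ]; omega
    · rw [hfP P hP hPQ]
  have hbS : u ^ h * f⁻¹ ∈ S := by
    intro P hP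
    rw [Place.mem_ring_iff (mul_ne_zero (pow_ne_zero _ hu0) (inv_ne_zero hf0)),
      Place.ord_mul (pow_ne_zero _ hu0) (inv_ne_zero hf0), Place.ord_inv, Place.ord_pow]
    by_cases hPQ : P = Q
    · rw [hPQ, hh, Place.isUniformizer_iff.1 hu]; omega
    · rw [hfP P hP hPQ]
      have := (Place.mem_ring_iff hu0).1 hP
      positivity
  have hC1 : CodimLE (scale u S) S N := by
    refine CodimLE.of_forall_dependent fun z hz => ?_
    obtain ⟨c, hc, m, hm, hsum⟩ := exists_dependent_mod (u := u) hu0 (ι := Fin (N + 1))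
      (by simp [hN]) S (fun m hm => mul_mem_regularOn huS hm) z hz
    exact ⟨c, hc, m, hm, hsum.symm⟩
  have hC2 := hC1.scale_pow hu0 h
  rw [← hg] at hC2
  -- In u^h S ⊆ f S ⊆ S the second inclusion is strict, since f vanishes at Q and so 1 is not in f
  -- S. This saves one of the hN conditions, whence g = hN - 1; dividing by f gives the claim.
  have hC3 : CodimLE (scale (u ^ h) S) (scale f S) g := by
    refine hC2.of_notMem (M' := scale f S) ?_ ?_ h1S ?_
    · rintro _ ⟨m, hm, rfl⟩
      exact mul_mem_regularOn hfS hm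
    · rintro _ ⟨m, hm, rfl⟩
      refine ⟨u ^ h * f⁻¹ * m, mul_mem_regularOn hbS hm, ?_⟩
      change f * (u ^ h * f⁻¹ * m) = u ^ h * m
      field_simp
    · rintro ⟨m, hm, h1⟩
      have h1 : f * m = 1 := h1
      have hm0 : m ≠ 0 := right_ne_zero_of_mul_eq_one h1
      have h2 := Place.ord_mul (P := Q) hf0 hm0
      rw [h1, Place.ord_one] at h2
      have := (Place.mem_ring_iff hm0).1 (hm Q hu.mem_ring)
      omega
  have hC4 := hC3.scale (inv_ne_zero hf0)
  rw [scale_scale, scale_scale, inv_mul_cancel₀ hf0, scale_one] at hC4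
  rwa [mul_comm f⁻¹] at hC4

theorem linearIndependent_pow_mul {x : F} (hx : Transcendental K x) {ι : Type*}
    {z : ι → F} (hz : LinearIndependent (IntermediateField.adjoin K {x}) z) (d : ℕ) :
    LinearIndependent K (fun ij : Fin d × ι => x ^ (ij.1 : ℕ) * z ij.2) := by
  let x' : IntermediateField.adjoin K {x} := ⟨x, IntermediateField.mem_adjoin_simple_self K x⟩
  have hx' : Transcendental K x' := by
    rintro ⟨q, hq0, hq⟩
    refine hx ⟨q, hq0, ?_⟩
    have := Polynomial.aeval_algebraMap_apply F x' q
    rwa [hq, map_zero] at this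
  have h1 : LinearIndependent K (fun i : Fin d => x' ^ (i : ℕ)) := by
    have h := (Polynomial.basisMonomials K).linearIndependent.map'
      (Polynomial.aeval (R := K) x').toLinearMap
      (LinearMap.ker_eq_bot.2 (transcendental_iff_injective.1 hx'))
    have h' := h.comp (Fin.val : Fin d → ℕ) Fin.val_injective
    have e : (fun i : Fin d => x' ^ (i : ℕ)) = ((Polynomial.aeval (R := K) x').toLinearMap ∘
        Polynomial.basisMonomials K) ∘ Fin.val := by
      funext i
      simp
    rw [e]
    exact h'
  exact linearIndependent_smul h1 hz

/-- The functions with poles at `Q` only form an infinite dimensional space. -/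
theorem IsFunctionField.not_codimLE_bot_regularOn (p : ℕ) [CharP F p] [Fact p.Prime] [Finite K]
    (hF : IsFunctionField K F) (Q : Place K F) (n : ℕ) :
    ¬ CodimLE ⊥ (regularOn {P : Place K F | P ≠ Q}) n := by
  rintro ⟨φ, hφ⟩
  obtain ⟨u, hu⟩ := Q.exists_isUniformizer
  have hu0 := hu.ne_zero
  have hDu := hF.D_ne_zero_of_isUniformizer p hu
  have hDx := D_inv_ne_zero hDu
  obtain ⟨f, h, g, hf0, hhpos, hg, hfP, hC⟩ := hF.exists_codimLE_scale p hu
  obtain ⟨A, -, -, -, -, -, hreg, -, hbasis⟩ := hF.exists_dedekind p hDx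
  obtain ⟨N, z, hz, hN⟩ : ∃ (N : ℕ) (z : Module.Basis (Fin N)
      (IntermediateField.adjoin K {u⁻¹}) F), (∀ i, z i ∈ A) ∧
      N = Module.finrank (IntermediateField.adjoin K {u}) F := by
    obtain ⟨z, hz⟩ := hbasis
    exact ⟨_, z, hz,
      congrArg (fun E : IntermediateField K F => Module.finrank E F) (adjoin_simple_inv u)⟩
  rw [← hN] at hg
  set S := regularOn {P : Place K F | u ∈ P.ring} with hS
  have huS : ∀ k : ℕ, u ^ k ∈ S := fun k P hP => pow_mem hP k
  have hfin := hF.finite_ord_pos p hu0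
  have hz0 : ∀ j, z j ≠ 0 := fun j => z.ne_zero j
  obtain ⟨c, hc⟩ : ∃ c : ℕ, ∀ j, u ^ c * z j ∈ S := by
    -- At zeros of u this exponent outweighs every pole of the `z j`. Elsewhere among the places of
    -- regularity u is a unit, so u⁻¹ and with it `z j` are regular.
    refine ⟨∑ P ∈ hfin.toFinset, ∑ j, (P.ord (z j)).natAbs, fun j P hP => ?_⟩
    by_cases hpos : 0 < P.ord u
    · rw [Place.mem_ring_iff (mul_ne_zero (pow_ne_zero _ hu0) (hz0 j)),
        Place.ord_mul (pow_ne_zero _ hu0) (hz0 j), Place.ord_pow]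
      have h1 : (P.ord (z j)).natAbs ≤ ∑ j, (P.ord (z j)).natAbs :=
        Finset.single_le_sum (f := fun j => (P.ord (z j)).natAbs) (fun _ _ => Nat.zero_le _)
          (Finset.mem_univ j)
      have h2 : ∑ j, (P.ord (z j)).natAbs ≤
          ∑ P ∈ hfin.toFinset, ∑ j, (P.ord (z j)).natAbs :=
        Finset.single_le_sum (f := fun P : Place K F => ∑ j, (P.ord (z j)).natAbs)
          (fun _ _ => Nat.zero_le _) (hfin.mem_toFinset.2 hpos)
      have h3 := h1.trans h2
      have h4 : -P.ord (z j) ≤ ((∑ P ∈ hfin.toFinset, ∑ j, (P.ord (z j)).natAbs : ℕ) : ℤ) := by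
        omega
      nlinarith
    · refine mul_mem (pow_mem hP _) (hreg P ?_ _ (hz j))
      rw [Place.mem_ring_iff (inv_ne_zero hu0), Place.ord_inv]
      omega
  -- The span of u^(-i) z_j with i ≤ d has dimension (d + 1)N, where d = hk - c. As hN = g + 1, this
  -- is kg + k - cN + N, and this k makes it exceed kg + n.
  let k := n + N * c + 1 + c
  have hkc : c ≤ h * k := by
    have : k ≤ h * k := Nat.le_mul_of_pos_left k hhpos
    omega
  obtain ⟨d, hd⟩ : ∃ d, h * k = d + c := ⟨h * k - c, by omega⟩
  have hli := linearIndependent_pow_mul (hF.transcendental_of_D_ne_zero hDx)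
    z.linearIndependent (d + 1)
  let Λ := Fintype.linearCombination K
    (fun ij : Fin (d + 1) × Fin N => u⁻¹ ^ (ij.1 : ℕ) * z ij.2)
  have hΛ : Function.Injective Λ := hli.fintypeLinearCombination_injective
  have hb0 : u ^ h * f⁻¹ ≠ 0 := mul_ne_zero (pow_ne_zero _ hu0) (inv_ne_zero hf0)
  obtain ⟨ψ, hψ⟩ := hC.scale_pow hb0 k
  have hΛx : ∀ a, ∀ P : Place K F, u⁻¹ ∈ P.ring → Λ a ∈ P.ring := by
    intro a P hP
    rw [Fintype.linearCombination_apply]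
    refine sum_mem fun ij _ => ?_
    rw [Algebra.smul_def]
    exact mul_mem (P.algebraMap_mem _) (mul_mem (pow_mem hP _) (hreg P hP _ (hz _)))
  have hΛu : ∀ a, u ^ (h * k) * Λ a ∈ S := by
    intro a
    rw [Fintype.linearCombination_apply, Finset.mul_sum]
    refine sum_mem fun ij _ => ?_
    rw [mul_smul_comm]
    refine Submodule.smul_mem _ _ ?_
    have hle : (ij.1 : ℕ) ≤ d := by have := ij.1.2; omega
    have : u ^ (h * k) * (u⁻¹ ^ (ij.1 : ℕ) * z ij.2) =
        u ^ (d - (ij.1 : ℕ)) * (u ^ c * z ij.2) := by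
      rw [hd, inv_pow, pow_sub₀ _ hu0 hle, pow_add]
      ring
    rw [this]
    exact mul_mem_regularOn (huS _) (hc _)
  -- The first component forces the combination into f^(-k) S, so that where u is regular its only
  -- pole is Q. Where u⁻¹ is regular it has no pole anyway. The second component is the supposed
  -- injection.
  let Θ : (Fin (d + 1) × Fin N → K) →ₗ[K] (Fin (k * g) → K) × (Fin n → K) :=
    (ψ ∘ₗ LinearMap.mulLeft K (u ^ (h * k)) ∘ₗ Λ).prod (φ ∘ₗ Λ)
  have hker : LinearMap.ker Θ ≠ ⊥ := by
    apply LinearMap.ker_ne_bot_of_finrank_lt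
    rw [Module.finrank_prod, Module.finrank_fin_fun, Module.finrank_fin_fun, Module.finrank_pi,
      Fintype.card_prod, Fintype.card_fin, Fintype.card_fin]
    have e1 : k * g + k = (d + c) * N := by
      rw [← hd]
      calc k * g + k = k * (g + 1) := by ring
        _ = _ := by rw [hg]; ring
    have e2 : k = n + N * c + 1 + c := rfl
    nlinarith
  obtain ⟨a, ha, ha0⟩ := Submodule.exists_mem_ne_zero_of_ne_bot hker
  have hΘ : Θ a = 0 := ha
  have h1 : ψ (u ^ (h * k) * Λ a) = 0 := congrArg Prod.fst hΘ
  have h2 : φ (Λ a) = 0 := congrArg Prod.snd hΘ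
  obtain ⟨s, hs, hsa⟩ := hψ _ (hΛu a) h1
  have hsa : (u ^ h * f⁻¹) ^ k * s = u ^ (h * k) * Λ a := hsa
  have hs' : Λ a = (f⁻¹) ^ k * s := by
    have hne : u ^ (h * k) ≠ 0 := pow_ne_zero _ hu0
    apply mul_left_cancel₀ hne
    rw [← hsa, mul_pow, ← pow_mul, mul_assoc]
  have hmem : Λ a ∈ regularOn {P : Place K F | P ≠ Q} := by
    intro P hPQ
    rcases P.mem_ring_or_inv_mem u with hP | hP
    · rw [hs']
      refine mul_mem (pow_mem ?_ k) (hs P hP)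
      rw [Place.mem_ring_iff (inv_ne_zero hf0), Place.ord_inv, hfP P hP hPQ, neg_zero]
    · exact hΛx a P hP
  have h0 : Λ a = 0 := hφ _ hmem h2
  exact ha0 (hΛ (by rw [h0, map_zero]))

/-- There is a separating function with a pole at `Q` only. -/
theorem IsFunctionField.exists_pole_only_at (p : ℕ) [CharP F p] [Fact p.Prime] [Finite K]
    (hF : IsFunctionField K F) (Q : Place K F) :
    ∃ y : F, D K F y ≠ 0 ∧ y ∉ Q.ring ∧ ∀ P : Place K F, P ≠ Q → y ∈ P.ring := by
  have hp : p.Prime := Fact.out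
  have hex : ∃ y : F, y ∉ Q.ring ∧ ∀ P : Place K F, P ≠ Q → y ∈ P.ring := by
    by_contra hcon
    push Not at hcon
    -- Otherwise functions regular off Q are regular everywhere, and a nonzero one has no zero.
    -- Reduction at Q would then embed their space in the residue field, contradicting infinite
    -- dimension.
    have hT : ∀ w ∈ regularOn {P : Place K F | P ≠ Q}, ∀ P : Place K F, w ∈ P.ring := by
      intro w hw P
      by_cases hPQ : P = Q
      · rw [hPQ]
        by_contra hwQ
        obtain ⟨P, hP, hPw⟩ := hcon w hwQ
        exact hPw (hw P hP)
      · exact hw P hPQ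
    have hfinκ := hF.finite_residueField p Q
    refine hF.not_codimLE_bot_regularOn p Q Q.degree (CodimLE.of_forall_dependent fun w hw => ?_)
    have hdep : ¬ LinearIndependent K
        (fun i => IsLocalRing.residue Q.ring ⟨w i, hT _ (hw i) Q⟩) := fun h => by
      have := h.fintype_card_le_finrank
      rw [Fintype.card_fin] at this
      exact absurd this (by rw [Place.degree]; omega)
    rw [Fintype.not_linearIndependent_iff] at hdep
    obtain ⟨c, hc, i₀, hi₀⟩ := hdep
    refine ⟨c, fun h => hi₀ (congrFun h i₀), ?_⟩
    have hres : IsLocalRing.residue Q.ring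
        (∑ i, algebraMap K Q.ring (c i) * ⟨w i, hT _ (hw i) Q⟩) = 0 := by
      rw [map_sum, ← hc]
      exact Finset.sum_congr rfl fun i _ => Place.residue_algebraMap_mul _ _
    rw [Place.residue_eq_zero_iff] at hres
    have hcoe : ((∑ i, algebraMap K Q.ring (c i) * ⟨w i, hT _ (hw i) Q⟩ : Q.ring) : F) =
        ∑ i, c i • w i := by
      rw [AddSubmonoidClass.coe_finsetSum]
      exact Finset.sum_congr rfl fun i _ => (Algebra.smul_def _ _).symm
    rw [hcoe] at hres
    have hsum : ∑ i, c i • w i ∈ regularOn {P : Place K F | P ≠ Q} :=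
      sum_mem fun i _ => Submodule.smul_mem _ _ (hw i)
    rcases hres with h | h
    · rw [Submodule.mem_bot, ← hcoe, h]; rfl
    · exact (hF.eq_zero_of_forall_mem_ring p (hT _ hsum) h).elim
  -- Taking p-th roots lowers the pole order while keeping the pole at Q alone, so it ends at a
  -- function with dy ≠ 0.
  have key : ∀ n : ℕ, ∀ y : F, y ∉ Q.ring → (∀ P : Place K F, P ≠ Q → y ∈ P.ring) →
      - Q.ord y ≤ n → ∃ y : F, D K F y ≠ 0 ∧ y ∉ Q.ring ∧ ∀ P : Place K F, P ≠ Q → y ∈ P.ring := by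
    intro n
    induction n with
    | zero =>
      intro y hy _ hle
      refine absurd ?_ hy
      have hy0 : y ≠ 0 := by rintro rfl; exact hy (zero_mem _)
      rw [Place.mem_ring_iff hy0]
      push_cast at hle
      omega
    | succ n ih =>
      intro y hy hreg hle
      by_cases hD : D K F y = 0
      · obtain ⟨g, rfl⟩ := hF.eq_pow_of_D_eq_zero p hD
        have hg0 : g ≠ 0 := by
          rintro rfl
          rw [zero_pow hp.ne_zero] at hy
          exact hy (zero_mem _)
        have h2 : (2 : ℤ) ≤ p := by exact_mod_cast hp.two_le
        rw [Place.mem_ring_iff (pow_ne_zero _ hg0), Place.ord_pow] at hy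
        have hneg : Q.ord g < 0 := by
          by_contra hneg
          exact hy (mul_nonneg (by omega) (by omega))
        refine ih g ?_ (fun P hP => ?_) ?_
        · rw [Place.mem_ring_iff hg0]; omega
        · have := hreg P hP
          rw [Place.mem_ring_iff (pow_ne_zero _ hg0), Place.ord_pow] at this
          rw [Place.mem_ring_iff hg0]
          by_contra hneg
          nlinarith
        · rw [Place.ord_pow] at hle
          push_cast at hle
          nlinarith
      · exact ⟨y, hD, hy, hreg⟩
  obtain ⟨y, hy, hreg⟩ := hex
  exact key (- Q.ord y).toNat y hy hreg (by omega)

end Poles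

/-! ### Units outside E and the independence of their logarithmic forms. -/

section Units

variable {K F : Type*} [Field K] [Field F] [Algebra K F]

/-- The vectors of orders, at the places in `I`, of the functions without zeros and poles
outside `E`. -/
def orderLattice (E : Finset (Place K F)) {I : Type*} (P : I → Place K F) :
    Submodule ℤ (I → ℤ) where
  carrier := {v | ∃ f : F, f ≠ 0 ∧ (∀ Q ∉ E, Q.ord f = 0) ∧ ∀ i, (P i).ord f = v i}
  zero_mem' := ⟨1, one_ne_zero, fun _ _ => Place.ord_one, fun _ => Place.ord_one⟩
  add_mem' := by
    rintro v w ⟨f, hf, hf1, hf2⟩ ⟨g, hg, hg1, hg2⟩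
    refine ⟨f * g, mul_ne_zero hf hg, fun Q hQ => ?_, fun i => ?_⟩
    · rw [Place.ord_mul hf hg, hf1 Q hQ, hg1 Q hQ, add_zero]
    · rw [Place.ord_mul hf hg, hf2, hg2, Pi.add_apply]
  smul_mem' := by
    rintro m v ⟨f, hf, hf1, hf2⟩
    refine ⟨f ^ m, zpow_ne_zero _ hf, fun Q hQ => ?_, fun i => ?_⟩
    · rw [Place.ord_zpow, hf1 Q hQ, mul_zero]
    · rw [Place.ord_zpow, hf2, Pi.smul_apply, smul_eq_mul]

theorem Place.ord_prod_zpow (P : Place K F) {ι : Type*} (s : Finset ι) {f : ι → F}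
    (hf : ∀ j, f j ≠ 0) (m : ι → ℤ) :
    P.ord (∏ j ∈ s, f j ^ m j) = ∑ j ∈ s, m j * P.ord (f j) := by
  classical
  induction s using Finset.induction_on with
  | empty => simp [Place.ord_one]
  | insert j s hj ih =>
    rw [Finset.prod_insert hj, Finset.sum_insert hj, Place.ord_mul (zpow_ne_zero _ (hf j))
      (Finset.prod_ne_zero_iff.2 fun k _ => zpow_ne_zero _ (hf k)), Place.ord_zpow, ih]

/-- The group of functions without zeros and poles outside `E` has at least `#E - 1` generators
that are independent modulo `p`-th powers. -/
theorem IsFunctionField.exists_independent_units (p : ℕ) [CharP F p] [Fact p.Prime] [Finite K]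
    (hF : IsFunctionField K F) (E : Finset (Place K F)) {r : ℕ} (hE : E.card = r + 1) :
    ∃ f : Fin r → F, (∀ j, f j ≠ 0) ∧ (∀ j, ∀ P ∉ E, P.ord (f j) = 0) ∧
      ∀ (m : Fin r → ℤ) (g : F), ∏ j, f j ^ m j = g ^ p → ∀ j, (p : ℤ) ∣ m j := by
  classical
  have hp : p.Prime := Fact.out
  obtain ⟨Q₀, hQ₀⟩ : E.Nonempty := Finset.card_pos.1 (by omega)
  obtain ⟨y, hDy, hyQ, hyP⟩ := hF.exists_pole_only_at p Q₀
  let I := {Q : Place K F // Q ∈ E.erase Q₀}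
  have hI : Fintype.card I = r := by
    rw [Fintype.card_coe, Finset.card_erase_of_mem hQ₀, hE, Nat.add_sub_cancel]
  have hne : ∀ i : I, i.1 ≠ Q₀ := fun i => Finset.ne_of_mem_erase i.2
  -- As y is regular off Q₀, each f i vanishes at i and has no other zero or pole except possibly at
  -- Q₀. Their order vectors are nonzero multiples of the unit vectors, so the lattice has full rank
  -- r.
  have hf := fun i : I => hF.exists_ord_pos_only_at p hDy (Q := i.1) (hyP _ (hne i))
  choose f hf0 hfpos hfP using hf
  let Λ := orderLattice E (fun i : I => i.1)
  have hfΛ : ∀ i : I, Pi.single i (i.1.ord (f i)) ∈ Λ := by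
    intro i
    refine ⟨f i, hf0 i, fun Q hQ => ?_, fun j => ?_⟩
    · refine hfP i Q (hyP Q ?_) ?_
      · rintro rfl; exact hQ hQ₀
      · rintro rfl; exact hQ (Finset.mem_of_mem_erase i.2)
    · by_cases hij : j = i
      · rw [hij, Pi.single_eq_same]
      · rw [Pi.single_eq_of_ne hij]
        exact hfP i j.1 (hyP _ (hne j)) fun h => hij (Subtype.ext h)
  obtain ⟨N, b⟩ := Submodule.basisOfPid (Pi.basisFun ℤ I) Λ
  have hrN : r ≤ N := by
    have hli : LinearIndependent ℤ
        (fun i : I => (⟨Pi.single i (i.1.ord (f i)), hfΛ i⟩ : Λ)) := by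
      rw [Fintype.linearIndependent_iff]
      intro c hc i
      have h1 := congrFun (congrArg (Subtype.val : Λ → (I → ℤ)) hc) i
      rw [AddSubmonoidClass.coe_finsetSum, Finset.sum_apply] at h1
      have h2 : c i * i.1.ord (f i) = 0 := by
        rw [Finset.sum_eq_single_of_mem i (Finset.mem_univ i)] at h1
        · simpa using h1
        · intro j _ hj
          simp [Pi.single_eq_of_ne (Ne.symm hj)]
      exact (mul_eq_zero.1 h2).resolve_right (hfpos i).ne'
    have hfinΛ : Module.Finite ℤ Λ := Module.Finite.of_basis b
    have := hli.fintype_card_le_finrank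
    rwa [hI, Module.finrank_eq_card_basis b, Fintype.card_fin] at this
  have hg := fun j : Fin r => (b (Fin.castLE hrN j)).2
  choose g hg0 hgE hgI using hg
  refine ⟨g, hg0, hgE, fun m w hw j => ?_⟩
  have hw0 : w ≠ 0 := by
    rintro rfl
    rw [zero_pow hp.ne_zero] at hw
    exact (Finset.prod_ne_zero_iff.2 fun j _ => zpow_ne_zero _ (hg0 j)) hw
  have hordw : ∀ P : Place K F, (p : ℤ) * P.ord w = ∑ j, m j * P.ord (g j) := by
    intro P
    rw [← Place.ord_pow, ← hw, P.ord_prod_zpow _ hg0]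
  have hp0 : (p : ℤ) ≠ 0 := by exact_mod_cast hp.ne_zero
  -- The p-th root w is again a unit outside E. Thus Σ m_j b_j lies in p Λ, and basis coordinates
  -- show that p divides each m_j.
  have hwΛ : (fun i : I => i.1.ord w) ∈ Λ := by
    refine ⟨w, hw0, fun Q hQ => ?_, fun i => rfl⟩
    have := hordw Q
    rw [Finset.sum_eq_zero fun j _ => by rw [hgE j Q hQ, mul_zero]] at this
    exact (mul_eq_zero.1 this).resolve_left hp0
  have hrel : ∑ j, m j • b (Fin.castLE hrN j) = (p : ℤ) • (⟨_, hwΛ⟩ : Λ) := by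
    apply Subtype.ext
    funext i
    rw [AddSubmonoidClass.coe_finsetSum, Finset.sum_apply]
    refine Eq.trans ?_ (hordw i.1).symm
    refine Finset.sum_congr rfl fun j _ => ?_
    rw [hgI j i]
    rfl
  have h3 := congrArg (fun v : Λ => b.repr v (Fin.castLE hrN j)) hrel
  simp only [map_sum, map_smul, Module.Basis.repr_self, Finsupp.finsetSum_apply,
    Finsupp.smul_apply, smul_eq_mul] at h3
  rw [Finset.sum_eq_single_of_mem j (Finset.mem_univ j)] at h3
  · rw [Finsupp.single_eq_same, mul_one] at h3
    exact ⟨_, h3⟩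
  · intro k _ hk
    rw [Finsupp.single_eq_of_ne (fun h => hk (Fin.castLE_injective hrN h).symm), mul_zero]

theorem exists_intCast_of_pow_eq {k : Type*} [Field k] {p : ℕ} [CharP k p] [Fact p.Prime] {d : k}
    (hd : d ^ p = d) : ∃ m : ℤ, (m : k) = d := by
  have hle : (⊥ : Subfield k) ≤ (ZMod.castHom (dvd_refl p) k).fieldRange := bot_le
  obtain ⟨z, rfl⟩ := hle ((Subfield.mem_bot_iff_pow_eq_self k p).2 hd)
  obtain ⟨m, rfl⟩ := ZMod.intCast_surjective z
  exact ⟨m, by simp⟩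

/-- Logarithmic forms of functions independent modulo `p`-th powers are independent over the
constants. -/
theorem IsFunctionField.linearIndependent_dlog (p : ℕ) [CharP F p] [Fact p.Prime] [Finite K]
    (hF : IsFunctionField K F) {ι : Type*} [Fintype ι] {f : ι → F} (hf : ∀ j, f j ≠ 0)
    (hind : ∀ (m : ι → ℤ) (g : F), ∏ j, f j ^ m j = g ^ p → ∀ j, (p : ℤ) ∣ m j) :
    LinearIndependent K (fun j => dlog K (f j)) := by
  classical
  have hp : p.Prime := Fact.out
  have hK : CharP K p := (algebraMap K F).charP (algebraMap K F).injective p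
  obtain ⟨x, hx⟩ := hF.exists_D_ne_zero p
  rw [linearIndependent_iff']
  intro s
  induction s using Finset.induction_on with
  | empty => simp
  | insert i s hi ih =>
    intro c hc
    rw [Finset.sum_insert hi] at hc
    have hci : c i = 0 := by
      by_contra hci
      -- Normalize the i-th coefficient to 1 and write the others as d_j^p. The Cartier operator
      -- turns the relation into one with coefficients d_j; subtracting removes i, so by induction
      -- d_j^p = d_j and d_j lies in the prime field.
      have hroot : ∀ j, ∃ d : K, d ^ p = (c i)⁻¹ * c j := fun j =>
        (PerfectRing.bijective_frobenius (R := K) (p := p)).2 _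
      choose d hd using hroot
      have h1 : dlog K (f i) + ∑ j ∈ s, d j ^ p • dlog K (f j) = 0 := by
        have := congrArg ((c i)⁻¹ • ·) hc
        simpa only [smul_add, Finset.smul_sum, smul_smul, inv_mul_cancel₀ hci, one_smul, ← hd,
          smul_zero] using this
      have hcart : IsCartierAt p x (dlog K (f i) + ∑ j ∈ s, d j ^ p • dlog K (f j))
          (dlog K (f i) + ∑ j ∈ s, d j • dlog K (f j)) := by
        refine IsCartierAt.add (hF.isCartier_dlog (hf i) x hx) (IsCartierAt.sum s fun j _ => ?_)
        have h := IsCartierAt.smul (algebraMap K F (d j)) (hF.isCartier_dlog (p := p) (hf j) x hx)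
        rwa [← map_pow, algebraMap_smul, algebraMap_smul] at h
      rw [h1] at hcart
      have h2 := hcart.eq_zero hx
      have h3 : ∑ j ∈ s, (d j ^ p - d j) • dlog K (f j) = 0 := by
        simp only [sub_smul, Finset.sum_sub_distrib]
        rw [sub_eq_zero]
        exact add_left_cancel (h1.trans h2.symm)
      have h4 := ih _ h3
      have hintegral : ∀ j : ι, ∃ m : ℤ, j ∈ s → (m : K) = d j := by
        intro j
        by_cases hj : j ∈ s
        · obtain ⟨m, hm⟩ := exists_intCast_of_pow_eq (sub_eq_zero.1 (h4 j hj))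
          exact ⟨m, fun _ => hm⟩
        · exact ⟨0, fun h => absurd h hj⟩
      choose m hm using hintegral
      -- Integer lifts of the coefficients: the product with these exponents has dlog zero, so it is
      -- a p-th power, although its i-th exponent is 1.
      let m' : ι → ℤ := fun j => if j = i then 1 else if j ∈ s then m j else 0
      have hprod : dlog K (∏ j, f j ^ m' j) = 0 := by
        rw [dlog_prod _ _ fun j _ => zpow_ne_zero _ (hf j), ← h2]
        simp only [dlog_zpow (hf _)]
        rw [← Finset.sum_subset (Finset.subset_univ (insert i s)), Finset.sum_insert hi]
        · congr 1
          · simp [m']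
          · refine Finset.sum_congr rfl fun j hj => ?_
            have hji : j ≠ i := by rintro rfl; exact hi hj
            simp only [m', hji, hj, if_true, if_false]
            rw [← hm j hj, Int.cast_smul_eq_zsmul]
        · intro j _ hj
          rw [Finset.mem_insert, not_or] at hj
          simp [m', hj.1, hj.2]
      have hprod0 : ∏ j, f j ^ m' j ≠ 0 :=
        Finset.prod_ne_zero_iff.2 fun j _ => zpow_ne_zero _ (hf j)
      have hD : D K F (∏ j, f j ^ m' j) = 0 :=
        (smul_eq_zero.1 hprod).resolve_left (inv_ne_zero hprod0)
      obtain ⟨g, hg⟩ := hF.eq_pow_of_D_eq_zero p hD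
      have h5 := hind m' g hg i
      simp only [m', if_true] at h5
      have := Int.le_of_dvd one_pos h5
      have := hp.one_lt
      omega
    rw [hci, zero_smul, zero_add] at hc
    intro j hj
    rcases Finset.mem_insert.1 hj with rfl | hj
    · exact hci
    · exact ih c hc j hj

end Units

/-! ### Residues and poles of logarithmic forms. -/

section LogarithmicForms

variable {K F : Type*} [Field K] [Field F] [Algebra K F]

theorem IsFunctionField.hasResidue_dlog (p : ℕ) [CharP F p] [Fact p.Prime] [PerfectField K]
    (hF : IsFunctionField K F) (P : Place K F) {f : F} (hf : f ≠ 0) :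
    P.HasResidue (dlog K f) (P.ord f : K) := by
  intro t ht
  obtain ⟨g, hg, hfg⟩ := hF.exists_dlog_eq p ht hf
  exact ⟨_, hfg, 0, fun _ => (P.ord f : K), rfl, by simpa using hg⟩

theorem HasResidue.sum {P : Place K F} {ι : Type*} (s : Finset ι) {ω : ι → Ω[F⁄K]} {c : ι → K}
    (h : ∀ j ∈ s, P.HasResidue (ω j) (c j)) :
    P.HasResidue (∑ j ∈ s, ω j) (∑ j ∈ s, c j) := by
  classical
  induction s using Finset.induction_on with
  | empty => simpa using HasResidue.zero P
  | insert j s hj ih =>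
    rw [Finset.sum_insert hj, Finset.sum_insert hj]
    exact HasResidue.add (h j (Finset.mem_insert_self j s))
      (ih fun i hi => h i (Finset.mem_insert_of_mem hi))

theorem IsFunctionField.ordGE_dlog (p : ℕ) [CharP F p] [Fact p.Prime] [PerfectField K]
    (hF : IsFunctionField K F) (P : Place K F) {f : F} (hf : f ≠ 0) :
    P.OrdGE (dlog K f) (-1) := by
  intro t ht
  obtain ⟨g, hg, hfg⟩ := hF.exists_dlog_eq p ht hf
  refine ⟨_, hfg, ?_⟩
  have h1 : P.val (t⁻¹) = WithZero.exp (-(-1) : ℤ) := by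
    rw [Place.val_eq_exp (inv_ne_zero ht.ne_zero), Place.ord_inv, Place.isUniformizer_iff.1 ht]
  have h2 : P.val (P.ord f : F) ≤ 1 := P.val_le_one_iff.2 (intCast_mem _ _)
  refine (P.val.map_add _ _).trans (max_le ?_ ?_)
  · rw [map_mul, h1]
    exact mul_le_of_le_one_left' h2
  · refine (P.val_le_one_iff.2 hg).trans ?_
    rw [← WithZero.exp_zero, WithZero.exp_le_exp]
    norm_num

/-- A combination of logarithmic forms whose residue at `P` vanishes is regular at `P`. -/
theorem IsFunctionField.ordGE_sum_smul_dlog (p : ℕ) [CharP F p] [Fact p.Prime] [PerfectField K]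
    (hF : IsFunctionField K F) (P : Place K F) {ι : Type*} [Fintype ι] {f : ι → F}
    (hf : ∀ j, f j ≠ 0) (c : ι → K) (hc : ∑ j, c j * (P.ord (f j) : K) = 0) :
    P.OrdGE (∑ j, c j • dlog K (f j)) 0 := by
  intro t ht
  have hg := fun j => hF.exists_dlog_eq p ht (hf j)
  choose g hg hfg using hg
  refine ⟨∑ j, algebraMap K F (c j) * g j, ?_, ?_⟩
  · have h1 : ∑ j, algebraMap K F (c j) * ((P.ord (f j) : F) * t⁻¹ + g j) =
        ∑ j, algebraMap K F (c j) * g j := by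
      simp only [mul_add, Finset.sum_add_distrib]
      have h0 : ∑ j, algebraMap K F (c j) * ((P.ord (f j) : F) * t⁻¹) = 0 := by
        have := congrArg (fun z => algebraMap K F z * t⁻¹) hc
        simpa [Finset.sum_mul, mul_assoc] using this
      rw [h0, zero_add]
    rw [← h1, Finset.sum_smul]
    refine Finset.sum_congr rfl fun j _ => ?_
    rw [hfg j, mul_smul, algebraMap_smul]
  · rw [neg_zero, WithZero.exp_zero, P.val_le_one_iff]
    exact sum_mem fun j _ => mul_mem (P.algebraMap_mem _) (hg j)

theorem IsFunctionField.isCartierIter_dlog (p : ℕ) [CharP F p] [Fact p.Prime] [PerfectField K]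
    (hF : IsFunctionField K F) {f : F} (hf : f ≠ 0) (e : ℕ) :
    IsCartierIter p e (dlog K f) (dlog K f) := by
  induction e with
  | zero => rfl
  | succ e ih => exact ⟨_, hF.isCartier_dlog hf, ih⟩

theorem IsCartierIter.sum {p e : ℕ} [Fact p.Prime] [CharP F p] {ι : Type*} (s : Finset ι)
    {ω : ι → Ω[F⁄K]} (h : ∀ j ∈ s, IsCartierIter p e (ω j) (ω j)) :
    IsCartierIter p e (∑ j ∈ s, ω j) (∑ j ∈ s, ω j) := by
  classical
  induction s using Finset.induction_on with
  | empty => simpa using IsCartierIter.zero e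
  | insert j s hj ih =>
    rw [Finset.sum_insert hj]
    exact (h j (Finset.mem_insert_self j s)).add
      (ih fun i hi => h i (Finset.mem_insert_of_mem hi))

/-- Linear independence over a subfield of the coordinate vectors gives linear independence of
the combinations over the big field. -/
theorem linearIndependent_sum_algebraMap_smul {k L V : Type*} [Field k] [Field L] [Algebra k L]
    [AddCommGroup V] [Module L V] {ι κ : Type*} [Fintype ι] [Fintype κ] {v : ι → V}
    (hv : LinearIndependent L v) {w : κ → ι → k} (hw : LinearIndependent k w) :
    LinearIndependent L (fun i => ∑ j, algebraMap k L (w i j) • v j) := by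
  rw [Fintype.linearIndependent_iff] at hv hw ⊢
  intro a ha i
  have h1 : ∑ j, (∑ i, a i * algebraMap k L (w i j)) • v j = 0 := by
    rw [← ha]
    simp only [Finset.sum_smul, Finset.smul_sum, smul_smul]
    exact Finset.sum_comm
  have h2 := hv _ h1
  -- Applying any k-linear functional L → k to the coordinate relations brings them down to k, where
  -- the vectors `w i` are independent.
  rw [← Module.forall_dual_apply_eq_zero_iff k]
  intro φ
  refine hw (fun i => φ (a i)) ?_ i
  funext j
  have h3 := congrArg φ (h2 j)
  rw [map_sum, map_zero] at h3
  rw [Finset.sum_apply, Pi.zero_apply, ← h3]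
  refine Finset.sum_congr rfl fun i _ => ?_
  rw [mul_comm (a i), ← Algebra.smul_def, map_smul, Pi.smul_apply, smul_eq_mul, smul_eq_mul,
    mul_comm]

end LogarithmicForms

/-! ### Bookkeeping for divisors. -/

section Divisors

variable {K F : Type*} [Field K] [Field F] [Algebra K F]

theorem Divisor.ofPoints_apply_self {n : ℕ} {P : Fin n → Place K F} (hP : Function.Injective P)
    (i : Fin n) : Divisor.ofPoints P (P i) = 1 := by
  classical
  rw [Divisor.ofPoints, Finsupp.finsetSum_apply, Finset.sum_eq_single_of_mem i (Finset.mem_univ i)]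
  · exact Finsupp.single_eq_same
  · intro j _ hj
    exact Finsupp.single_eq_of_ne fun h => hj (hP h).symm

theorem Divisor.ofPoints_apply_of_forall_ne {n : ℕ} {P : Fin n → Place K F} {Q : Place K F}
    (hQ : ∀ i, P i ≠ Q) : Divisor.ofPoints P Q = 0 := by
  rw [Divisor.ofPoints, Finsupp.finsetSum_apply]
  exact Finset.sum_eq_zero fun i _ => Finsupp.single_eq_of_ne (hQ i).symm

theorem Divisor.support_ofPoints [DecidableEq (Place K F)] {n : ℕ} {P : Fin n → Place K F}
    (hP : Function.Injective P) : (Divisor.ofPoints P).support = Finset.univ.image P := by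
  ext Q
  rw [Finsupp.mem_support_iff, Finset.mem_image]
  constructor
  · intro h
    by_contra hcon
    push Not at hcon
    exact h (Divisor.ofPoints_apply_of_forall_ne fun i => hcon i (Finset.mem_univ i))
  · rintro ⟨i, -, rfl⟩
    rw [Divisor.ofPoints_apply_self hP]
    exact one_ne_zero

theorem Divisor.exists_eq_ofNat {A : Divisor K F} (hA : 0 ≤ A) :
    ∃ B : Place K F →₀ ℕ, A = Divisor.ofNat B ∧
      A.deg = ((B.sum fun P m => m * P.degree : ℕ) : ℤ) := by
  have hB : A = Divisor.ofNat (A.mapRange Int.toNat rfl) := by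
    ext P
    have : 0 ≤ A P := hA P
    simp only [Divisor.ofNat, Finsupp.mapRange_apply]
    omega
  refine ⟨_, hB, ?_⟩
  conv_lhs => rw [hB]
  rw [Divisor.deg, Divisor.ofNat, Finsupp.sum_mapRange_index (by simp), Finsupp.sum, Finsupp.sum]
  push_cast
  rfl

end Divisors

/-! ### Comparing dimensions over the two fields. -/

section LinearAlgebra

theorem finrank_le_finrank_of_forall_sum_mem {k L V : Type*} [Field k] [Field L] [Algebra k L]
    [AddCommGroup V] [Module L V] {ι : Type*} [Fintype ι] {v : ι → V}
    (hv : LinearIndependent L v) {W : Submodule L V} [Module.Finite L W]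
    {N : Submodule k (ι → k)} (h : ∀ c ∈ N, ∑ j, algebraMap k L (c j) • v j ∈ W) :
    Module.finrank k N ≤ Module.finrank L W := by
  let b := Module.finBasis k N
  have hli : LinearIndependent k (fun i => (b i : ι → k)) :=
    b.linearIndependent.map' N.subtype (Submodule.ker_subtype N)
  have hliW : LinearIndependent L (fun i => (⟨_, h (b i) (b i).2⟩ : W)) :=
    LinearIndependent.of_comp W.subtype (linearIndependent_sum_algebraMap_smul hv hli)
  have := hliW.fintype_card_le_finrank
  rwa [Fintype.card_fin] at this

theorem finrank_le_finrank_map_add_finrank_inf_ker {k V W : Type*} [Field k] [AddCommGroup V]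
    [Module k V] [Module.Finite k V] [AddCommGroup W] [Module k W] (ρ : V →ₗ[k] W)
    (H : Submodule k V) :
    Module.finrank k H ≤
      Module.finrank k (H.map ρ) + Module.finrank k (H ⊓ LinearMap.ker ρ : Submodule k V) := by
  have h1 := (ρ.domRestrict H).finrank_range_add_finrank_ker
  rw [LinearMap.range_domRestrict] at h1
  have h2 : (LinearMap.ker (ρ.domRestrict H)).map H.subtype ≤ H ⊓ LinearMap.ker ρ := by
    rintro _ ⟨c, hc, rfl⟩
    exact ⟨c.2, hc⟩
  have h3 := Submodule.finrank_mono h2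
  rw [Submodule.finrank_map_subtype_eq] at h3
  omega

end LinearAlgebra

/-! ### The dimension count. -/

section Codes

variable {K F : Type*} [Field K] [Field F] [Algebra K F] {k : Type*} [Field k] [Algebra k K]

/-- The dimension count: logarithmic forms with values in a subfield, conditions, residues. -/
theorem IsFunctionField.card_le_finrank_Car {p e : ℕ} [Fact p.Prime] [CharP F p] [Finite K]
    (hF : IsFunctionField K F) (hk : Nat.card k = p ^ e) {n r d : ℕ} {P : Fin n → Place K F}
    {G : Divisor K F} (hG : ∀ i, G (P i) = 0) {f : Fin r → F}
    (hf : ∀ j, f j ≠ 0)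
    (hind : ∀ (m : Fin r → ℤ) (g : F), ∏ j, f j ^ m j = g ^ p → ∀ j, (p : ℤ) ∣ m j)
    {M : Submodule K Ω[F⁄K]} (hM : ∀ j, dlog K (f j) ∈ M)
    (hcodim : CodimLE (Omega (G - Divisor.ofPoints P)) M d) :
    r ≤ Module.finrank k (Car p hk P G) + d * Module.finrank k K + h1 G := by
  have hfink : Finite k := Finite.of_injective _ (algebraMap k K).injective
  have hfinK : Module.Finite k K := Module.Finite.of_finite
  have hfinG := hF.finite_Omega p G
  obtain ⟨ψ, hψ⟩ := hcodim
  let ω : (Fin r → k) → Ω[F⁄K] := fun c => ∑ j, algebraMap k K (c j) • dlog K (f j)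
  -- T is the obstruction to lying in Ω(G - D), and ρ below is the residue map, with values in k
  -- because the residues of the dlog f_j are integers.
  let T : (Fin r → k) →ₗ[k] (Fin d → K) := Fintype.linearCombination k (fun j => ψ (dlog K (f j)))
  let ρ : (Fin r → k) →ₗ[k] (Fin n → k) :=
    Fintype.linearCombination k (fun j i => ((P i).ord (f j) : k))
  have hωM : ∀ c, ω c ∈ M := fun c => sum_mem fun j _ => Submodule.smul_mem _ _ (hM j)
  have hψω : ∀ c, ψ (ω c) = T c := by
    intro c
    simp only [ω, T, Fintype.linearCombination_apply, map_sum, map_smul, algebraMap_smul]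
  have hres : ∀ c i, algebraMap k K (ρ c i) =
      ∑ j, algebraMap k K (c j) * ((P i).ord (f j) : K) := by
    intro c i
    simp [ρ, Fintype.linearCombination_apply, Finset.sum_apply]
  have hmem : ∀ c ∈ LinearMap.ker T, ω c ∈ Omega (G - Divisor.ofPoints P) := fun c hc =>
    hψ _ (hωM c) ((hψω c).trans hc)
  have hCar : (LinearMap.ker T).map ρ ≤ Car p hk P G := by
    rintro _ ⟨c, hc, rfl⟩
    refine ⟨ω c, hmem c hc, IsCartierIter.sum _ fun j _ => ?_, fun i => ?_⟩
    · have h := (hF.isCartierIter_dlog p (hf j) e).smul (algebraMap k K (c j))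
      have := Fintype.ofFinite k
      rwa [← map_pow, ← hk, Nat.card_eq_fintype_card, FiniteField.pow_card] at h
    · rw [hres]
      exact HasResidue.sum _ fun j _ => HasResidue.smul _ (hF.hasResidue_dlog p (P i) (hf j))
  -- With zero residue the form is regular at each P_l, where G has multiplicity 0; elsewhere G - D
  -- equals G. So the form lies in Ω(G).
  have hker : Module.finrank k (LinearMap.ker T ⊓ LinearMap.ker ρ : Submodule k (Fin r → k)) ≤
      h1 G := by
    refine finrank_le_finrank_of_forall_sum_mem (hF.linearIndependent_dlog p hf hind) ?_
    rintro c ⟨hc1, hc2⟩ Q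
    have hc2 : ρ c = 0 := hc2
    by_cases hQ : ∃ l, P l = Q
    · obtain ⟨l, rfl⟩ := hQ
      rw [hG l]
      refine hF.ordGE_sum_smul_dlog p (P l) hf _ ?_
      rw [← hres, hc2, Pi.zero_apply, map_zero]
    · push Not at hQ
      have := hmem c hc1 Q
      rwa [Finsupp.sub_apply, Divisor.ofPoints_apply_of_forall_ne hQ, sub_zero] at this
  have hle := finrank_le_finrank_map_add_finrank_inf_ker ρ (LinearMap.ker T)
  have hCar' := Submodule.finrank_mono hCar
  have h3 := T.finrank_range_add_finrank_ker
  have h4 : Module.finrank k (LinearMap.range T) ≤ d * Module.finrank k K := by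
    refine (Submodule.finrank_le _).trans ?_
    rw [Module.finrank_pi_fintype]
    simp
  rw [Module.finrank_fin_fun] at h3
  omega

end Codes

end CartierCode

/-! ### The bound for Cartier codes. -/

theorem mainTheorem4 {p e q ℓ : ℕ} [Fact p.Prime]
    {Fq K F : Type*} [Field Fq] [Field K] [Field F] [Algebra Fq K] [Algebra K F] [CharP F p]
    (hq : q = p ^ e) (hFq : Nat.card Fq = p ^ e) (hK : Nat.card K = q ^ ℓ)
    (hF : CartierCode.IsFunctionField K F)
    {n : ℕ} (P : Fin n → CartierCode.Place K F) (hP : Function.Injective P)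
    (hrat : ∀ i, (P i).degree = 1)
    (D : CartierCode.Divisor K F) (hD : D = CartierCode.Divisor.ofPoints P)
    (G Gplus Gminus : CartierCode.Divisor K F)
    (hG : G = Gplus - Gminus) (hplus : 0 ≤ Gplus) (hminus : 0 ≤ Gminus)
    (hred : CartierCode.Divisor.IsReduced Gminus)
    (hdisj : Disjoint Gplus.support Gminus.support)
    (hplusD : Disjoint Gplus.support D.support)
    (hminusD : Disjoint Gminus.support D.support) :
    (Module.finrank Fq (CartierCode.Car p hFq P G) : ℤ) ≥
      (n : ℤ) - 1 + (Gminus.support.card : ℤ) - (ℓ : ℤ) * CartierCode.Divisor.deg Gplus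
        - (CartierCode.h1 G : ℤ) := by
  classical
  have hp : p.Prime := Fact.out
  subst hD hq
  have hfinK : Finite K := Nat.finite_of_card_ne_zero (by
    rw [hK]; exact pow_ne_zero _ (pow_ne_zero _ hp.ne_zero))
  have hfinFq : Finite Fq := Finite.of_injective _ (algebraMap Fq K).injective
  obtain ⟨B, hB, hdeg⟩ := CartierCode.Divisor.exists_eq_ofNat hplus
  rw [hdeg]
  set d := B.sum fun P m => m * P.degree
  have hsupp := CartierCode.Divisor.support_ofPoints hP
  have hrank : Module.finrank Fq K = ℓ := by
    have h1 := Module.natCard_eq_pow_finrank (K := Fq) (V := K)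
    rw [hK, hFq] at h1
    refine (Nat.pow_right_injective ?_ h1).symm
    rw [← hFq]
    exact Finite.one_lt_card
  set E : Finset (CartierCode.Place K F) := Finset.univ.image P ∪ Gminus.support with hE
  have hcard : E.card = n + Gminus.support.card := by
    rw [hE, Finset.card_union_of_disjoint (by rw [← hsupp]; exact hminusD.symm),
      Finset.card_image_of_injective _ hP, Finset.card_univ, Fintype.card_fin]
  -- If E is empty then n + s = 0 and the right-hand side is at most -1, so there is nothing to
  -- prove; otherwise r = #E - 1 makes sense.
  rcases Nat.eq_zero_or_pos E.card with h0 | hpos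
  · have h1 : (0 : ℤ) ≤ (ℓ : ℤ) * (d : ℤ) := by positivity
    omega
  obtain ⟨r, hr⟩ : ∃ r, E.card = r + 1 := ⟨E.card - 1, by omega⟩
  obtain ⟨f, hf0, hfE, hind⟩ := hF.exists_independent_units p E hr
  have hGP : ∀ i, G (P i) = 0 := by
    intro i
    have hi : P i ∈ (CartierCode.Divisor.ofPoints P).support := by
      rw [hsupp]; exact Finset.mem_image_of_mem P (Finset.mem_univ i)
    have h1 := Finsupp.notMem_support_iff.1 (Finset.disjoint_right.1 hplusD hi)
    have h2 := Finsupp.notMem_support_iff.1 (Finset.disjoint_right.1 hminusD hi)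
    rw [hG, Finsupp.sub_apply, h1, h2, sub_zero]
  have hM : ∀ j, CartierCode.dlog K (f j) ∈
      CartierCode.Omega (- (Gminus + CartierCode.Divisor.ofPoints P)) := by
    intro j Q
    rw [Finsupp.neg_apply, Finsupp.add_apply]
    by_cases hQ : Q ∈ E
    · have h1 : Gminus Q + CartierCode.Divisor.ofPoints P Q = 1 := by
        rcases Finset.mem_union.1 hQ with h | h
        · obtain ⟨i, -, rfl⟩ := Finset.mem_image.1 h
          have hi : P i ∈ (CartierCode.Divisor.ofPoints P).support := by rwa [hsupp]
          rw [Finsupp.notMem_support_iff.1 (Finset.disjoint_right.1 hminusD hi),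
            CartierCode.Divisor.ofPoints_apply_self hP, zero_add]
        · rw [hred Q h, Finsupp.notMem_support_iff.1 (Finset.disjoint_left.1 hminusD h), add_zero]
      rw [h1]
      exact hF.ordGE_dlog p Q (hf0 j)
    · have hQ' := hQ
      rw [hE, Finset.mem_union, not_or, ← hsupp, Finsupp.notMem_support_iff,
        Finsupp.notMem_support_iff] at hQ'
      rw [hQ'.1, hQ'.2, add_zero, neg_zero]
      have := hF.ordGE_sum_smul_dlog p Q (fun _ : Unit => hf0 j) (fun _ => (1 : K)) (by
        simp [hfE j Q hQ])
      simpa using this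
  have hcod := hF.codimLE_Omega_add p B (- (Gminus + CartierCode.Divisor.ofPoints P))
  -- Only the effective part G^+ separates the divisor allowed to logarithmic forms from G - D, so
  -- only deg G^+ conditions are paid.
  have hdiv : - (Gminus + CartierCode.Divisor.ofPoints P) + CartierCode.Divisor.ofNat B =
      G - CartierCode.Divisor.ofPoints P := by
    rw [hG, hB]; abel
  rw [hdiv] at hcod
  have hmain := hF.card_le_finrank_Car hFq hGP hf0 hind hM hcod
  rw [hrank] at hmain
  have h5 : (r : ℤ) ≤ Module.finrank Fq (CartierCode.Car p hFq P G) + d * ℓ +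
      CartierCode.h1 G := by exact_mod_cast hmain
  have h6 : (r : ℤ) + 1 = n + Gminus.support.card := by
    omega
  rw [mul_comm (ℓ : ℤ)]
  linarith
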